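/- Let $\alpha>0$, $\beta>0$ and $\tilde u\in\mathbb R$ be constants and let $f\in C^2(\mathbb R)$ be real-valued. Let $u_0:\mathbb R\to\mathbb R$ satisfy $u_0-\tilde u\in L^2(\mathbb R)$ and $\partial_xu_0\in H^2(\mathbb R)$ (weak derivative). Consider the Cauchy problem for the generalized Benjamin–Bona–Mahony–Burgers equation with both far field states equal to $\tilde u$, $$ \partial_t u+\partial_x\big(f(u)\big)-\alpha\,\partial_t\partial_x^2u-\beta\,\partial_x^2u=0\quad(t>0,\ x\in\mathbb R),\qquad u(0,x)=u_0(x)\to\tilde u\quad(x\to\pm\infty). $$ By a global solution we mean a function $u=u(t,x)$, $t\ge 0$, with $u-\tilde u\in C^0([0,\infty);H^3(\mathbb R))$ and $u(0,\cdot)=u_0$ almost everywhere that satisfies the equation in the sense of distributions on $(0,\infty)\times\mathbb R$. Then there is one and only one global solution $u$ (functions that agree for every $t\ge0$ and almost every $x$ being identified). It satisfies $$ u-\tilde u\in C^0([0,\infty);H^3),\qquad \partial_xu\in L^2(0,\infty;H^2),\qquad \partial_tu\in L^2(0,\infty;H^2), $$ and, taking for each $t\ge 0$ the $C^2$ representative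 of $u(t,\cdot)$, $$ \lim_{t\to\infty}\Big(\sup_{x\in\mathbb R}|u(t,x)-\tilde u|+\sup_{x\in\mathbb R}|\partial_xu(t,x)|+\sup_{x\in\mathbb R}|\partial_x^2u(t,x)|\Big)=0 . $$ -/

import Mathlib

open MeasureTheory Set Filter Topology TopologicalSpace
open scoped ENNReal ContDiff Distributions

noncomputable section

namespace BBMBurgers

/-- `g` is the weak (distributional) derivative of `v` on `ℝ`: both are locally integrable, and
`∫ v ψ' = -∫ g ψ` for every `ψ ∈ C_c^∞(ℝ)`. -/
def HasWeakDeriv (v g : ℝ → ℝ) : Prop :=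
  LocallyIntegrable v ∧ LocallyIntegrable g ∧
    ∀ ψ : 𝓓((⊤ : Opens ℝ), ℝ), ∫ x, v x * deriv ψ x = - ∫ x, g x * ψ x

theorem integrable_mul_testFunction {v : ℝ → ℝ} (hv : LocallyIntegrable v)
    (ψ : 𝓓((⊤ : Opens ℝ), ℝ)) : Integrable fun x => v x * ψ x := by
  simpa [mul_comm] using hv.integrable_smul_left_of_hasCompactSupport ψ.continuous
    ψ.hasCompactSupport

theorem integrable_mul_deriv_testFunction {v : ℝ → ℝ} (hv : LocallyIntegrable v)
    (ψ : 𝓓((⊤ : Opens ℝ), ℝ)) : Integrable fun x => v x * deriv ψ x := by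
  have h : Continuous (deriv ψ) := ψ.contDiff.continuous_deriv (by simp)
  simpa [mul_comm] using hv.integrable_smul_left_of_hasCompactSupport h
    ψ.hasCompactSupport.deriv

theorem HasWeakDeriv.congr {v w g h : ℝ → ℝ} (H : HasWeakDeriv v g) (hv : v =ᵐ[volume] w)
    (hg : g =ᵐ[volume] h) : HasWeakDeriv w h := by
  obtain ⟨h1, h2, h3⟩ := H
  refine ⟨h1.congr hv, h2.congr hg, fun ψ => ?_⟩
  have e1 : ∫ x, w x * deriv ψ x = ∫ x, v x * deriv ψ x :=
    integral_congr_ae (by filter_upwards [hv] with x hx; rw [hx])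
  have e2 : ∫ x, h x * ψ x = ∫ x, g x * ψ x :=
    integral_congr_ae (by filter_upwards [hg] with x hx; rw [hx])
  rw [e1, e2, h3]

theorem HasWeakDeriv.zero : HasWeakDeriv 0 0 :=
  ⟨locallyIntegrable_zero, locallyIntegrable_zero, fun ψ => by simp⟩

theorem HasWeakDeriv.add {v w g h : ℝ → ℝ} (H : HasWeakDeriv v g) (K : HasWeakDeriv w h) :
    HasWeakDeriv (v + w) (g + h) := by
  obtain ⟨h1, h2, h3⟩ := H
  obtain ⟨k1, k2, k3⟩ := K
  refine ⟨h1.add k1, h2.add k2, fun ψ => ?_⟩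
  simp only [Pi.add_apply, add_mul]
  rw [integral_add (integrable_mul_deriv_testFunction h1 ψ)
      (integrable_mul_deriv_testFunction k1 ψ),
    integral_add (integrable_mul_testFunction h2 ψ) (integrable_mul_testFunction k2 ψ),
    h3, k3]
  ring

theorem HasWeakDeriv.smul {v g : ℝ → ℝ} (c : ℝ) (H : HasWeakDeriv v g) :
    HasWeakDeriv (c • v) (c • g) := by
  obtain ⟨h1, h2, h3⟩ := H
  refine ⟨h1.smul c, h2.smul c, fun ψ => ?_⟩
  simp only [Pi.smul_apply, smul_eq_mul, mul_assoc]
  rw [integral_const_mul, integral_const_mul, h3]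
  ring

/-- The Sobolev space `H^k(ℝ)` of real-valued functions. A function `v ∈ H^k` is represented by the
tuple `(v, v', …, v^{(k)})` of `L²` functions in which every entry is the weak derivative of the
preceding one; the tuple is determined by its zeroth entry `v`. The norm, inherited from the
`ℓ²`-product of `k + 1` copies of `L²(ℝ)`, is
`‖v‖_{H^k} = (∑_{j ≤ k} ‖v^{(j)}‖_{L²}²)^{1/2}`. -/
def SobolevH (k : ℕ) : Submodule ℝ (PiLp 2 fun _ : Fin (k + 1) => Lp ℝ 2 (volume : Measure ℝ)) where
  carrier := {v | ∀ j : Fin k, HasWeakDeriv (v j.castSucc) (v j.succ)}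
  zero_mem' := fun _ =>
    HasWeakDeriv.zero.congr (Lp.coeFn_zero ℝ 2 volume).symm (Lp.coeFn_zero ℝ 2 volume).symm
  add_mem' := fun {_ _} hv hw j =>
    ((hv j).add (hw j)).congr (Lp.coeFn_add _ _).symm (Lp.coeFn_add _ _).symm
  smul_mem' := fun c _ hv j =>
    ((hv j).smul c).congr (Lp.coeFn_smul _ _).symm (Lp.coeFn_smul _ _).symm

/-- The underlying function (defined up to null sets) of an element of `H^k(ℝ)`. -/
def sobolevFn {k : ℕ} (v : SobolevH k) : ℝ → ℝ :=
  ((v : PiLp 2 fun _ : Fin (k + 1) => Lp ℝ 2 (volume : Measure ℝ)) 0 : ℝ → ℝ)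

/-- `w ∈ C⁰([0, ∞); H^k)`, for a function `w = w(t, x)`: the map that sends `t ≥ 0` to the class of
`w(t, ·)` takes values in `H^k(ℝ)` and is continuous for the norm of `H^k`. -/
def MemCSobolev (k : ℕ) (w : ℝ → ℝ → ℝ) : Prop :=
  ∃ Φ : ℝ → SobolevH k, ContinuousOn Φ (Ici 0) ∧ ∀ t ≥ 0, w t =ᵐ[volume] sobolevFn (Φ t)

/-- The open half-plane `{(t, x) : t > 0}`. -/
def halfPlane : Opens (ℝ × ℝ) := ⟨{p | 0 < p.1}, isOpen_lt continuous_const continuous_fst⟩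

/-- `∂_x u ∈ L²(0, ∞; H^k)`, with the weak derivative in `x`. -/
def XDerivMemL2Sobolev (k : ℕ) (u : ℝ → ℝ → ℝ) : Prop :=
  ∃ V : ℝ → SobolevH k, MemLp V 2 (volume.restrict (Ioi 0)) ∧
    ∀ᵐ t ∂(volume.restrict (Ioi 0)), HasWeakDeriv (u t) (sobolevFn (V t))

/-- `∂_t u ∈ L²(0, ∞; H^k)`, with `∂_t` the derivative in the sense of distributions on
`(0, ∞) × ℝ`. -/
def TDerivMemL2Sobolev (k : ℕ) (u : ℝ → ℝ → ℝ) : Prop :=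
  ∃ W : ℝ → SobolevH k, MemLp W 2 (volume.restrict (Ioi 0)) ∧
    ∀ ψ : 𝓓(halfPlane, ℝ),
      ∫ t in Ioi (0 : ℝ), ∫ x, u t x * deriv (fun s => ψ (s, x)) t =
        - ∫ t in Ioi (0 : ℝ), ∫ x, sobolevFn (W t) x * ψ (t, x)

/-- The equation `∂_t u + ∂_x (f(u)) - α ∂_t ∂_x² u - β ∂_x² u = 0` holds in the sense of
distributions on `(0, ∞) × ℝ`: all derivatives are moved to the test function `ψ`. -/
def SolvesEquation (α β : ℝ) (f : ℝ → ℝ) (u : ℝ → ℝ → ℝ) : Prop :=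
  ∀ ψ : 𝓓(halfPlane, ℝ),
    ∫ t in Ioi (0 : ℝ), ∫ x,
      (u t x * deriv (fun s => ψ (s, x)) t
        + f (u t x) * deriv (fun y => ψ (t, y)) x
        - α * (u t x * deriv (fun s => iteratedDeriv 2 (fun y => ψ (s, y)) x) t)
        + β * (u t x * iteratedDeriv 2 (fun y => ψ (t, y)) x)) = 0

/-- `u` is a global in time solution, with `u - c ∈ C⁰([0, ∞); H³)`, of the Cauchy problem
`∂_t u + ∂_x (f(u)) - α ∂_t ∂_x² u - β ∂_x² u = 0`, `u(0, ·) = u₀`, with both far field states equal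
to `c`. Only the values `u t x` with `t ≥ 0` matter. -/
structure IsGlobalSolution (α β c : ℝ) (f u₀ : ℝ → ℝ) (u : ℝ → ℝ → ℝ) : Prop where
  regularity : MemCSobolev 3 fun t x => u t x - c
  initial : u 0 =ᵐ[volume] u₀
  equation : SolvesEquation α β f u

end BBMBurgers

end

noncomputable section

namespace BBMBurgers

/-! Put u = c + w and F(s) = f(c + s) - f(c). Inverting 1 - α∂² turns the equation into ∂_t w = -(1
- α∂²)⁻¹∂(F(w) - β ∂w). The right side loses no derivatives, so this is an ordinary differential
equation in H¹, with a Lipschitz field when F is Lipschitz. With the energy inner product ⟨v, w⟩ +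
α⟨v', w'⟩ on H¹, the operators (1 - α∂²)⁻¹ and -(1 - α∂²)⁻¹∂ are the Hilbert adjoints `res` and
`dres` of the inclusion and of the derivative H¹ → L²; all their properties follow by duality.

F is first truncated to a compactly supported C² flux. Since ∫ F(w) w' = 0 for every such flux
(`inner_nem_der`), the energy satisfies d/dt ‖w‖² = -2β‖w'‖² and does not increase for t ≥ 0. The
embedding of H¹ into bounded functions then keeps w in the range where F was left unchanged, so the
global solution of the truncated equation solves the original one.

For regularity, β `dres` ∘ ∂ = (β/α)(1 - `res`) on H¹. Hence w_x solves in L² a damped linear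
equation whose forcing lies in H¹, and Duhamel's formula keeps it in H¹ (`exists_lift_solution`).
Doing this twice gives w(t) ∈ H³.

For decay, the energy identity puts w_x in L²(0, ∞; L²). The forcing F'(w) w_x in the equation for
w_x is then square integrable, and so is w_xx; then F(w)_xx is, because w_x is bounded, and so is
w_xxx. The time derivatives follow from the equation. A square integrable curve with square
integrable derivative tends to zero, so w_x and w_xx tend to zero in H¹, hence uniformly; w follows
from w² ≤ 2‖w‖‖w_x‖.

For uniqueness, testing a distributional solution with products θ(t)φ(x) shows that it satisfies the
integrated equation in H¹ (`IsGlobalSolution.integral_eq`). Two solutions are bounded on each [0,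
T], one truncation serves both, and uniqueness for Lipschitz fields applies. -/

/-! ### Locally absolutely continuous functions and weak derivatives -/

/-- `v` is locally absolutely continuous with almost everywhere derivative `g`. -/
structure HasACDeriv (v g : ℝ → ℝ) : Prop where
  ac : ∀ a b, AbsolutelyContinuousOnInterval v a b
  ae : ∀ᵐ x, HasDerivAt v (g x) x

/-- On a bounded interval v takes values in some [-C, C], where a C¹ function is Lipschitz;
Lipschitz maps preserve absolute continuity. -/
theorem absolutelyContinuousOnInterval_comp {F v : ℝ → ℝ} {a b : ℝ} (hF : ContDiff ℝ 1 F)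
    (hv : AbsolutelyContinuousOnInterval v a b) :
    AbsolutelyContinuousOnInterval (fun x => F (v x)) a b := by
  obtain ⟨C, hC⟩ := hv.exists_bound
  obtain ⟨K, hK⟩ := hF.contDiffOn.exists_lipschitzOnWith (s := Icc (-C) C) (by decide)
    (convex_Icc _ _) isCompact_Icc
  rw [absolutelyContinuousOnInterval_iff] at hv ⊢
  intro ε hε
  -- Dividing by K + 1 covers a vanishing Lipschitz constant.
  obtain ⟨δ, hδ, H⟩ := hv (ε / (K + 1)) (by positivity)
  refine ⟨δ, hδ, fun E hE hE' => ?_⟩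
  have hmem : ∀ x ∈ uIcc a b, v x ∈ Icc (-C) C := fun x hx => abs_le.1 (hC x hx)
  calc ∑ i ∈ Finset.range E.1, dist (F (v (E.2 i).1)) (F (v (E.2 i).2))
      ≤ ∑ i ∈ Finset.range E.1, K * dist (v (E.2 i).1) (v (E.2 i).2) := by
        refine Finset.sum_le_sum fun i hi => ?_
        exact hK.dist_le_mul _ (hmem _ (hE.1 i hi).1) _ (hmem _ (hE.1 i hi).2)
    _ = K * ∑ i ∈ Finset.range E.1, dist (v (E.2 i).1) (v (E.2 i).2) := by rw [Finset.mul_sum]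
    _ ≤ K * (ε / (K + 1)) := by gcongr; exact (H E hE hE').le
    _ < (K + 1) * (ε / (K + 1)) := by gcongr; linarith
    _ = ε := by field

namespace HasACDeriv

variable {v w g h : ℝ → ℝ}

theorem continuous (H : HasACDeriv v g) : Continuous v := by
  refine continuous_iff_continuousAt.2 fun x => ?_
  have := (H.ac (x - 1) (x + 1)).continuousOn
  rw [uIcc_of_le (by linarith)] at this
  exact this.continuousAt (Icc_mem_nhds (by linarith) (by linarith))

theorem deriv_ae (H : HasACDeriv v g) : deriv v =ᵐ[volume] g := by
  filter_upwards [H.ae] with x hx using hx.deriv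

theorem locallyIntegrable (H : HasACDeriv v g) : LocallyIntegrable g := by
  refine LocallyIntegrable.congr (f := deriv v) ?_ H.deriv_ae
  rw [locallyIntegrable_iff]
  intro k hk
  obtain ⟨r, hr, hkr⟩ := hk.isBounded.subset_closedBall_lt 0 0
  rw [Real.closedBall_eq_Icc] at hkr
  refine IntegrableOn.mono_set ?_ hkr
  have := (H.ac (0 - r) (0 + r)).intervalIntegrable_deriv
  rwa [intervalIntegrable_iff_integrableOn_Icc_of_le (by linarith)] at this

theorem intervalIntegrable (H : HasACDeriv v g) (a b : ℝ) : IntervalIntegrable g volume a b :=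
  (H.locallyIntegrable.integrableOn_isCompact isCompact_uIcc).intervalIntegrable

theorem integral_eq_sub (H : HasACDeriv v g) (a b : ℝ) : ∫ x in a..b, g x = v b - v a := by
  rw [← (H.ac a b).integral_deriv_eq_sub]
  refine intervalIntegral.integral_congr_ae ?_
  filter_upwards [H.deriv_ae] with x hx _ using hx.symm

theorem congr_deriv (H : HasACDeriv v g) (e : g =ᵐ[volume] h) : HasACDeriv v h :=
  ⟨H.ac, by filter_upwards [H.ae, e] with x hx e using e ▸ hx⟩

theorem mul (H : HasACDeriv v g) (K : HasACDeriv w h) :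
    HasACDeriv (fun x => v x * w x) (fun x => g x * w x + v x * h x) :=
  ⟨fun a b => (H.ac a b).fun_mul (K.ac a b), by
    filter_upwards [H.ae, K.ae] with x hx hy using hx.mul hy⟩

theorem comp (H : HasACDeriv v g) {F : ℝ → ℝ} (hF : ContDiff ℝ 1 F) :
    HasACDeriv (fun x => F (v x)) (fun x => deriv F (v x) * g x) :=
  ⟨fun a b => absolutelyContinuousOnInterval_comp hF (H.ac a b), by
    filter_upwards [H.ae] with x hx
    exact ((hF.differentiable one_ne_zero _).hasDerivAt).comp x hx⟩

theorem of_contDiff (hv : ContDiff ℝ 1 v) : HasACDeriv v (deriv v) :=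
  ⟨fun _ _ => hv.contDiffOn.absolutelyContinuousOnInterval,
    .of_forall fun x => (hv.differentiable one_ne_zero x).hasDerivAt⟩

theorem of_integral (hg : LocallyIntegrable g) (c a : ℝ) :
    HasACDeriv (fun x => c + ∫ t in a..x, g t) g := by
  have hi : ∀ a b, IntervalIntegrable g volume a b := fun a b =>
    (hg.integrableOn_isCompact isCompact_uIcc).intervalIntegrable
  refine ⟨fun x y => ?_, ?_⟩
  · have e : (fun x => c + ∫ t in a..x, g t) =
        fun z => (fun _ => c + ∫ t in a..x, g t) z + (fun z => ∫ t in x..z, g t) z := by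
      ext z
      simp only
      rw [add_assoc, intervalIntegral.integral_add_adjacent_intervals (hi _ _) (hi _ _)]
    rw [e]
    exact (contDiff_const.contDiffOn.absolutelyContinuousOnInterval).add
      ((hi x y).absolutelyContinuousOnInterval_intervalIntegral left_mem_uIcc)
  · filter_upwards [LocallyIntegrable.ae_hasDerivAt_integral hg] with x hx using (hx a).const_add c

theorem hasDerivAt (H : HasACDeriv v g) (hg : Continuous g) (x : ℝ) : HasDerivAt v (g x) x := by
  have e : v = fun x => v 0 + ∫ t in (0 : ℝ)..x, g t := by
    ext x; rw [H.integral_eq_sub]; ring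
  rw [e]
  exact (intervalIntegral.integral_hasDerivAt_right (H.intervalIntegrable _ _)
    (hg.stronglyMeasurableAtFilter _ _) hg.continuousAt).const_add _

/-- An integrable function with integrable derivative vanishes at `±∞`. -/
theorem tendsto_zero (H : HasACDeriv v g) (hv : Integrable v) (hg : Integrable g) :
    Tendsto v atTop (𝓝 0) ∧ Tendsto v atBot (𝓝 0) := by
  have e : v = fun x => v 0 + ∫ t in (0 : ℝ)..x, g t := by
    ext x; rw [H.integral_eq_sub]; ring
  have h1 : Tendsto v atTop (𝓝 (v 0 + ∫ t in Ioi (0 : ℝ), g t)) := by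
    conv => enter [1]; rw [e]
    exact tendsto_const_nhds.add
      (intervalIntegral_tendsto_integral_Ioi 0 hg.integrableOn tendsto_id)
  have h2 : Tendsto v atBot (𝓝 (v 0 + -∫ t in Iic (0 : ℝ), g t)) := by
    conv => enter [1]; rw [e]
    simp_rw [intervalIntegral.integral_symm _ (0 : ℝ)]
    exact tendsto_const_nhds.add
      (intervalIntegral_tendsto_integral_Iic 0 hg.integrableOn tendsto_id).neg
  -- Every neighbourhood of +∞ contains a half-line, of infinite measure, so an integrable function
  -- can have no limit there other than zero.
  have z1 := (hv.integrableAtFilter atTop).eq_zero_of_tendsto (fun s hs => by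
    obtain ⟨a, ha⟩ := mem_atTop_sets.1 hs
    exact top_unique (le_trans (by simp) (measure_mono (μ := volume) (s := Ici a) ha))) h1
  have z2 := (hv.integrableAtFilter atBot).eq_zero_of_tendsto (fun s hs => by
    obtain ⟨a, ha⟩ := mem_atBot_sets.1 hs
    exact top_unique (le_trans (by simp) (measure_mono (μ := volume) (s := Iic a) ha))) h2
  rw [z1] at h1
  rw [z2] at h2
  exact ⟨h1, h2⟩

theorem eq_integral_Iic (H : HasACDeriv v g) (hv : Integrable v) (hg : Integrable g) (x : ℝ) :
    v x = ∫ t in Iic x, g t := by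
  have h := intervalIntegral_tendsto_integral_Iic x hg.integrableOn tendsto_id
  simp only [id, H.integral_eq_sub] at h
  have := tendsto_const_nhds (x := v x).sub (H.tendsto_zero hv hg).2
  simpa using tendsto_nhds_unique this h

theorem integral_eq_zero (H : HasACDeriv v g) (hv : Integrable v) (hg : Integrable g) :
    ∫ t, g t = 0 := by
  have h := intervalIntegral_tendsto_integral hg tendsto_neg_atTop_atBot tendsto_id
  simp only [id, H.integral_eq_sub] at h
  have := (H.tendsto_zero hv hg).1.sub ((H.tendsto_zero hv hg).2.comp tendsto_neg_atTop_atBot)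
  simpa using tendsto_nhds_unique h this

theorem hasWeakDeriv (H : HasACDeriv v g) : HasWeakDeriv v g := by
  refine ⟨H.continuous.locallyIntegrable, H.locallyIntegrable, fun ψ => ?_⟩
  have h1 : HasACDeriv ψ (deriv ψ) := of_contDiff (ψ.contDiff.of_le (by simp))
  have i1 := integrable_mul_testFunction H.continuous.locallyIntegrable ψ
  have i2 := integrable_mul_testFunction H.locallyIntegrable ψ
  have i3 := integrable_mul_deriv_testFunction H.continuous.locallyIntegrable ψ
  have := (H.mul h1).integral_eq_zero i1 (i2.add i3)
  rw [integral_add i2 i3] at this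
  linarith

end HasACDeriv

/-- **Du Bois-Reymond lemma** on an open interval. -/
theorem ae_eq_const_of_integral_mul_deriv_eq_zero {s : Set ℝ} (hs : IsOpen s)
    (hs' : s.OrdConnected) (hne : s.Nonempty) {v : ℝ → ℝ} (hv : LocallyIntegrable v)
    (h : ∀ ψ : ℝ → ℝ, ContDiff ℝ ∞ ψ → HasCompactSupport ψ → tsupport ψ ⊆ s →
      ∫ x, v x * deriv ψ x = 0) :
    ∃ c, ∀ᵐ x, x ∈ s → v x = c := by
  obtain ⟨x₀, hx₀⟩ := hne
  obtain ⟨r, hr, hrs⟩ := Metric.isOpen_iff.1 hs x₀ hx₀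
  let b : ContDiffBump x₀ := ⟨r / 4, r / 2, by linarith, by linarith⟩
  set ψ₀ : ℝ → ℝ := b.normed volume with hψ₀
  have hψ₀s : tsupport ψ₀ ⊆ s := by
    rw [hψ₀, b.tsupport_normed_eq]
    exact (Metric.closedBall_subset_ball (by simp only [b]; linarith)).trans hrs
  have hψ₀d : ContDiff ℝ ∞ ψ₀ := b.contDiff_normed
  have hψ₀c : HasCompactSupport ψ₀ := b.hasCompactSupport_normed
  have hψ₀i : ∫ x, ψ₀ x = 1 := b.integral_normed
  have hint : ∀ ψ : ℝ → ℝ, Continuous ψ → HasCompactSupport ψ →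
      Integrable (fun x => v x * ψ x) := fun ψ h1 h2 => by
    simpa [mul_comm] using hv.integrable_smul_left_of_hasCompactSupport h1 h2
  refine ⟨∫ x, v x * ψ₀ x, ?_⟩
  have key := hs.ae_eq_zero_of_integral_contDiff_smul_eq_zero (μ := volume)
    (f := fun x => v x - ∫ x, v x * ψ₀ x)
    ((hv.sub (locallyIntegrable_const _)).locallyIntegrableOn _) ?_
  · filter_upwards [key] with x hx hxs using sub_eq_zero.1 (hx hxs)
  intro g hg hgc hgs
  set m := ∫ x, g x with hm
  -- Subtracting `m * ψ₀` gives mean zero, so the primitive χ of φ has compact support in s and is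
  -- admissible. The resulting ∫ v φ = 0 is ∫ g (v - ∫ v ψ₀) = 0.
  set φ : ℝ → ℝ := fun x => g x - m * ψ₀ x with hφ
  have hφd : ContDiff ℝ ∞ φ := hg.sub (contDiff_const.mul hψ₀d)
  have ig : Integrable g := hg.continuous.integrable_of_hasCompactSupport hgc
  have iψ : Integrable ψ₀ := hψ₀d.continuous.integrable_of_hasCompactSupport hψ₀c
  have hφi : ∫ x, φ x = 0 := by
    rw [hφ, integral_sub ig (iψ.const_mul _), integral_const_mul, hψ₀i]; simp [hm]
  set K := tsupport g ∪ tsupport ψ₀ with hK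
  have hKc : IsCompact K := hgc.isCompact.union hψ₀c.isCompact
  have hKs : K ⊆ s := union_subset hgs hψ₀s
  have hKn : K.Nonempty := by
    have : (tsupport ψ₀).Nonempty := by
      rw [hψ₀, b.tsupport_normed_eq]; exact ⟨x₀, Metric.mem_closedBall_self b.rOut_pos.le⟩
    exact this.mono subset_union_right
  set p := sInf K
  set q := sSup K
  have hpK : p ∈ K := hKc.sInf_mem hKn
  have hqK : q ∈ K := hKc.sSup_mem hKn
  have hKpq : K ⊆ Icc p q := fun x hx =>
    ⟨csInf_le hKc.bddBelow hx, le_csSup hKc.bddAbove hx⟩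
  have hpqs : Icc p q ⊆ s := hs'.out (hKs hpK) (hKs hqK)
  have hφ0 : ∀ x, x ∉ Icc p q → φ x = 0 := fun x hx => by
    have h1 : x ∉ tsupport g := fun h => hx (hKpq (Or.inl h))
    have h2 : x ∉ tsupport ψ₀ := fun h => hx (hKpq (Or.inr h))
    simp [hφ, image_eq_zero_of_notMem_tsupport h1, image_eq_zero_of_notMem_tsupport h2]
  set χ : ℝ → ℝ := fun x => ∫ t in p..x, φ t with hχ
  have hχd : ∀ x, HasDerivAt χ (φ x) x := fun x =>
    intervalIntegral.integral_hasDerivAt_right (hφd.continuous.intervalIntegrable _ _)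
      (hφd.continuous.stronglyMeasurableAtFilter _ _) hφd.continuous.continuousAt
  have hχ' : deriv χ = φ := funext fun x => (hχd x).deriv
  have hχs : Function.support χ ⊆ Icc p q := by
    intro x hx
    by_contra hxn
    refine hx ?_
    rcases lt_or_ge x p with hxp | hxp
    · refine (intervalIntegral.integral_congr_ae (g := fun _ => 0) ?_).trans (by simp)
      filter_upwards [compl_mem_ae_iff.2 (measure_singleton p)] with y hy hy'
      rw [uIoc_of_ge hxp.le] at hy'
      exact hφ0 y fun h => hy (le_antisymm hy'.2 h.1)
    · have hxq : q < x := by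
        by_contra h'; exact hxn ⟨hxp, not_lt.1 h'⟩
      show ∫ t in p..x, φ t = 0
      rw [intervalIntegral.integral_of_le hxp, ← hφi]
      refine setIntegral_eq_integral_of_ae_compl_eq_zero ?_
      filter_upwards [compl_mem_ae_iff.2 (measure_singleton p)] with y hy hy'
      refine hφ0 y fun h => hy' ⟨lt_of_le_of_ne h.1 fun h' => hy h'.symm, h.2.trans hxq.le⟩
  have hχts : tsupport χ ⊆ Icc p q := closure_minimal hχs isClosed_Icc
  have := h χ (contDiff_infty_iff_deriv.2 ⟨fun x => (hχd x).differentiableAt, hχ' ▸ hφd⟩)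
    (HasCompactSupport.of_support_subset_isCompact isCompact_Icc hχs) (hχts.trans hpqs)
  rw [hχ'] at this
  have e1 : ∫ x, v x * φ x = (∫ x, v x * g x) - m * ∫ x, v x * ψ₀ x := by
    rw [← integral_const_mul, ← integral_sub (hint g hg.continuous hgc)
      ((hint ψ₀ hψ₀d.continuous hψ₀c).const_mul m)]
    exact integral_congr_ae (.of_forall fun x => by simp only [hφ]; ring)
  have e2 : ∫ x, g x • (v x - ∫ x, v x * ψ₀ x) =
      (∫ x, v x * g x) - m * ∫ x, v x * ψ₀ x := by
    rw [hm, ← integral_mul_const, ← integral_sub (hint g hg.continuous hgc) (ig.mul_const _)]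
    exact integral_congr_ae (.of_forall fun x => by simp only [smul_eq_mul]; ring)
  rw [e2, ← e1, this]

/-- A function with a weak derivative has a locally absolutely continuous representative. -/
theorem HasWeakDeriv.exists_hasACDeriv {v g : ℝ → ℝ} (H : HasWeakDeriv v g) :
    ∃ v', v =ᵐ[volume] v' ∧ HasACDeriv v' g := by
  have hG := HasACDeriv.of_integral H.2.1 0 0
  obtain ⟨c, hc⟩ := ae_eq_const_of_integral_mul_deriv_eq_zero isOpen_univ ordConnected_univ
    ⟨0, trivial⟩ (H.1.sub hG.continuous.locallyIntegrable) (fun ψ h1 h2 _ => by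
      let ψ' : 𝓓((⊤ : Opens ℝ), ℝ) := ⟨ψ, h1, h2, subset_univ _⟩
      have e1 := H.2.2 ψ'
      have e2 := hG.hasWeakDeriv.2.2 ψ'
      have i1 := integrable_mul_deriv_testFunction H.1 ψ'
      have i2 := integrable_mul_deriv_testFunction hG.continuous.locallyIntegrable ψ'
      have := integral_sub i1 i2
      rw [e1, e2, sub_self] at this
      refine Eq.trans (integral_congr_ae (.of_forall fun x => ?_)) this
      simp only [Pi.sub_apply, sub_mul]; rfl)
  refine ⟨fun x => c + ∫ t in (0 : ℝ)..x, g t, ?_, HasACDeriv.of_integral H.2.1 c 0⟩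
  filter_upwards [hc] with x hx
  have := hx trivial
  simp only [Pi.sub_apply, zero_add] at this
  linarith

/-! ### Weak derivatives of square integrable functions -/

/-- The space `L²(ℝ)`. -/
abbrev L2 := Lp ℝ 2 (volume : Measure ℝ)

open Classical in
/-- The class in `L²` of a function (zero if the function is not square integrable). -/
def toL2 (φ : ℝ → ℝ) : L2 := if h : MemLp φ 2 volume then h.toLp φ else 0

theorem coeFn_toL2 {φ : ℝ → ℝ} (h : MemLp φ 2 volume) : toL2 φ =ᵐ[volume] φ := by
  rw [toL2, dif_pos h]; exact h.coeFn_toLp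

theorem L2.inner_eq (v g : L2) : inner ℝ v g = ∫ x, v x * g x := by
  rw [MeasureTheory.L2.inner_def]
  exact integral_congr_ae (.of_forall fun x => mul_comm _ _)

theorem L2.integrable_mul (v g : L2) : Integrable fun x => v x * g x := by
  refine (MeasureTheory.L2.integrable_inner (𝕜 := ℝ) v g).congr (.of_forall fun x => mul_comm _ _)

theorem inner_toL2 (v : L2) {φ : ℝ → ℝ} (h : MemLp φ 2 volume) :
    inner ℝ v (toL2 φ) = ∫ x, v x * φ x := by
  rw [L2.inner_eq]
  exact integral_congr_ae (by filter_upwards [coeFn_toL2 h] with x hx; rw [hx])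

theorem L2.integral_abs_mul_le (v g : L2) : ∫ x, |v x * g x| ≤ ‖v‖ * ‖g‖ := by
  have h := real_inner_le_norm |v| |g|
  rw [norm_abs_eq_norm, norm_abs_eq_norm, L2.inner_eq] at h
  refine le_of_eq_of_le (integral_congr_ae ?_) h
  filter_upwards [Lp.coeFn_abs v, Lp.coeFn_abs g] with x h1 h2
  rw [h1, h2, abs_mul]

theorem L2.locallyIntegrable (v : L2) : LocallyIntegrable v :=
  (Lp.memLp v).locallyIntegrable (by norm_num)

theorem testFunction_memLp (ψ : 𝓓((⊤ : Opens ℝ), ℝ)) : MemLp ψ 2 volume :=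
  ψ.continuous.memLp_of_hasCompactSupport ψ.hasCompactSupport

theorem deriv_testFunction_memLp (ψ : 𝓓((⊤ : Opens ℝ), ℝ)) : MemLp (deriv ψ) 2 volume :=
  (ψ.contDiff.continuous_deriv (by simp)).memLp_of_hasCompactSupport ψ.hasCompactSupport.deriv

theorem hasWeakDeriv_iff {v g : L2} : HasWeakDeriv v g ↔ ∀ ψ : 𝓓((⊤ : Opens ℝ), ℝ),
    inner ℝ v (toL2 (deriv ψ)) = - inner ℝ g (toL2 ψ) := by
  simp only [inner_toL2 _ (testFunction_memLp _), inner_toL2 _ (deriv_testFunction_memLp _)]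
  exact ⟨fun h => h.2.2, fun h => ⟨L2.locallyIntegrable v, L2.locallyIntegrable g, h⟩⟩

theorem HasWeakDeriv.coe_add {v w g h : L2} (H : HasWeakDeriv v g) (K : HasWeakDeriv w h) :
    HasWeakDeriv (v + w : L2) (g + h : L2) :=
  (H.add K).congr (Lp.coeFn_add _ _).symm (Lp.coeFn_add _ _).symm

theorem HasWeakDeriv.coe_smul {v g : L2} (c : ℝ) (H : HasWeakDeriv v g) :
    HasWeakDeriv (c • v : L2) (c • g : L2) :=
  (H.smul c).congr (Lp.coeFn_smul _ _).symm (Lp.coeFn_smul _ _).symm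

/-- Each test function imposes an equation between continuous functions of the pair. This is what
makes the energy space complete. -/
theorem isClosed_hasWeakDeriv : IsClosed {p : L2 × L2 | HasWeakDeriv p.1 p.2} := by
  simp only [hasWeakDeriv_iff, ofPred_forall]
  exact isClosed_iInter fun ψ => isClosed_eq (by fun_prop) (by fun_prop)

/-- Integration by parts in `H¹`. -/
theorem HasWeakDeriv.inner_eq_neg {v g w h : L2} (H : HasWeakDeriv v g) (K : HasWeakDeriv w h) :
    inner ℝ v h = - inner ℝ g w := by
  obtain ⟨v', hv, Hv⟩ := H.exists_hasACDeriv
  obtain ⟨w', hw, Hw⟩ := K.exists_hasACDeriv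
  have i1 : Integrable fun x => v' x * w' x := (L2.integrable_mul v w).congr (by
    filter_upwards [hv, hw] with x h1 h2; rw [h1, h2])
  have i2 : Integrable fun x => g x * w' x := (L2.integrable_mul g w).congr (by
    filter_upwards [hw] with x h2; rw [h2])
  have i3 : Integrable fun x => v' x * h x := (L2.integrable_mul v h).congr (by
    filter_upwards [hv] with x h2; rw [h2])
  have := (Hv.mul Hw).integral_eq_zero i1 (i2.add i3)
  rw [integral_add i2 i3] at this
  rw [L2.inner_eq, L2.inner_eq]
  have e1 : ∫ x, v x * h x = ∫ x, v' x * h x :=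
    integral_congr_ae (by filter_upwards [hv] with x h2; rw [h2])
  have e2 : ∫ x, g x * w x = ∫ x, g x * w' x :=
    integral_congr_ae (by filter_upwards [hw] with x h2; rw [h2])
  linarith

theorem HasWeakDeriv.unique {v : ℝ → ℝ} {g h : ℝ → ℝ} (H : HasWeakDeriv v g)
    (K : HasWeakDeriv v h) : g =ᵐ[volume] h := by
  refine ae_eq_of_integral_contDiff_smul_eq H.2.1 K.2.1 fun ψ h1 h2 => ?_
  have e1 := H.2.2 ⟨ψ, h1, h2, subset_univ _⟩
  have e2 := K.2.2 ⟨ψ, h1, h2, subset_univ _⟩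
  rw [e1, neg_inj] at e2
  simpa [mul_comm] using e2

/-! ### The energy space -/

/-- The space `H¹(ℝ)` with the energy norm `‖v‖² + α ‖v'‖²`: the pairs `(v, √α v')`. -/
def energySubmodule (α : ℝ) : Submodule ℝ (WithLp 2 (L2 × L2)) where
  carrier := {p | HasWeakDeriv p.fst ((√α)⁻¹ • p.snd : L2)}
  zero_mem' := by
    have : HasWeakDeriv (0 : L2) (0 : L2) :=
      HasWeakDeriv.zero.congr (Lp.coeFn_zero ℝ 2 volume).symm (Lp.coeFn_zero ℝ 2 volume).symm
    simpa using this
  add_mem' := fun {p q} hp hq => by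
    have : HasWeakDeriv (p.fst + q.fst : L2) ((√α)⁻¹ • p.snd + (√α)⁻¹ • q.snd : L2) :=
      hp.coe_add hq
    simpa using this
  smul_mem' := fun c p hp => by
    have : HasWeakDeriv (c • p.fst : L2) (c • (√α)⁻¹ • p.snd : L2) := hp.coe_smul c
    rw [smul_comm] at this
    simpa using this

/-- The space `H¹(ℝ)` with the energy norm. -/
def EnergySpace (α : ℝ) : Type := energySubmodule α

namespace EnergySpace

variable {α : ℝ}

instance : NormedAddCommGroup (EnergySpace α) :=
  inferInstanceAs (NormedAddCommGroup (energySubmodule α))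

instance : InnerProductSpace ℝ (EnergySpace α) :=
  inferInstanceAs (InnerProductSpace ℝ (energySubmodule α))

instance : CompleteSpace (EnergySpace α) := by
  change CompleteSpace (energySubmodule α)
  refine IsClosed.completeSpace_coe (hs := ?_)
  have : Continuous fun p : WithLp 2 (L2 × L2) => (p.fst, (√α)⁻¹ • p.snd) := by
    have h1 : Continuous fun p : WithLp 2 (L2 × L2) => p.fst := WithLp.continuous_fst ..
    have h2 : Continuous fun p : WithLp 2 (L2 × L2) => p.snd := WithLp.continuous_snd ..
    fun_prop
  exact isClosed_hasWeakDeriv.preimage this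

variable (α) in
/-- The inclusion `H¹ → L²`. -/
def val : EnergySpace α →L[ℝ] L2 := (WithLp.fstL 2 ℝ L2 L2).comp (energySubmodule α).subtypeL

variable (α) in
/-- The derivative `H¹ → L²`. -/
def der : EnergySpace α →L[ℝ] L2 :=
  (√α)⁻¹ • (WithLp.sndL 2 ℝ L2 L2).comp (energySubmodule α).subtypeL

theorem hasWeakDeriv (W : EnergySpace α) : HasWeakDeriv (val α W) (der α W) := W.2

theorem ext {V W : EnergySpace α} [Fact (0 < α)] (h : val α V = val α W) : V = W := by
  have h1 := V.hasWeakDeriv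
  rw [h] at h1
  have h2 : der α V = der α W := Lp.ext (h1.unique W.hasWeakDeriv)
  have hα : (√α)⁻¹ ≠ 0 := by
    have := Fact.out (p := 0 < α); positivity
  have h3 : V.1.snd = W.1.snd := smul_right_injective L2 hα h2
  exact Subtype.ext (WithLp.ofLp_injective 2 (Prod.ext h h3))

/-- Integrate (v²)' = 2 v v' from -∞ and apply Cauchy–Schwarz. -/
theorem rep_sq_le {v g : L2} {v' : ℝ → ℝ} (hv : v =ᵐ[volume] v')
    (H : HasACDeriv v' g) (x : ℝ) : v' x ^ 2 ≤ 2 * (‖v‖ * ‖g‖) := by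
  have i1 : Integrable fun x => v' x * v' x := (L2.integrable_mul v v).congr (by
    filter_upwards [hv] with x h1; rw [h1])
  have i2 : Integrable fun x => g x * v' x + v' x * g x :=
    ((L2.integrable_mul v g).const_mul 2).congr (by
      filter_upwards [hv] with x h2; rw [h2]; ring)
  have := (H.mul H).eq_integral_Iic i1 i2 x
  rw [pow_two, this]
  calc ∫ t in Iic x, (g t * v' t + v' t * g t) ≤ ∫ t in Iic x, |g t * v' t + v' t * g t| :=
        integral_mono i2.integrableOn i2.abs.integrableOn fun _ => le_abs_self _
    _ ≤ ∫ t, |g t * v' t + v' t * g t| :=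
        setIntegral_le_integral i2.abs (.of_forall fun _ => abs_nonneg _)
    _ = 2 * ∫ t, |v t * g t| := by
        rw [← integral_const_mul]
        refine integral_congr_ae ?_
        filter_upwards [hv] with t ht
        rw [ht, show g t * v' t + v' t * g t = 2 * (v' t * g t) by ring, abs_mul, abs_two]
    _ ≤ 2 * (‖v‖ * ‖g‖) := by gcongr; exact L2.integral_abs_mul_le v g

theorem two_mul_norm_le (hα : 0 < α) (a b : ℝ) :
    2 * (a * b) ≤ (√α)⁻¹ * (a ^ 2 + α * b ^ 2) := by
  have h0 : 0 < √α := Real.sqrt_pos.2 hα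
  rw [le_inv_mul_iff₀ h0]
  nlinarith [sq_nonneg (a - √α * b), Real.mul_self_sqrt hα.le]

/-! ### Resolvent operators as Hilbert adjoints -/

variable (α) in
/-- The operator `(1 - α ∂²)⁻¹ : L² → H¹`. -/
def res : L2 →L[ℝ] EnergySpace α := (val α).adjoint

variable (α) in
/-- The operator `-(1 - α ∂²)⁻¹ ∂ : L² → H¹`. -/
def dres : L2 →L[ℝ] EnergySpace α := (der α).adjoint

/-- The weak form of V - αV'' = h. -/
theorem inner_res (h : L2) (W : EnergySpace α) :
    inner ℝ (res α h) W = inner ℝ h (val α W) :=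
  ContinuousLinearMap.adjoint_inner_left ..

/-- The weak form of V - αV'' = -h', meaningful for h merely in L². -/
theorem inner_dres (h : L2) (W : EnergySpace α) :
    inner ℝ (dres α h) W = inner ℝ h (der α W) :=
  ContinuousLinearMap.adjoint_inner_left ..

theorem eq_of_inner {V W : EnergySpace α} (h : ∀ U, inner ℝ V U = inner ℝ W U) : V = W :=
  ext_inner_right ℝ h

theorem dres_val (W : EnergySpace α) : dres α (val α W) = - res α (der α W) := by
  refine eq_of_inner fun U => ?_
  rw [inner_neg_left, inner_res, inner_dres, W.hasWeakDeriv.inner_eq_neg U.hasWeakDeriv]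

theorem exists_rep (W : EnergySpace α) : ∃ v', val α W =ᵐ[volume] v' ∧ HasACDeriv v' (der α W) :=
  W.hasWeakDeriv.exists_hasACDeriv

variable [hα : Fact (0 < α)]

theorem inner_def (V W : EnergySpace α) :
    inner ℝ V W = inner ℝ (val α V) (val α W) + α * inner ℝ (der α V) (der α W) := by
  have e : inner ℝ V W = inner ℝ V.1.fst W.1.fst + inner ℝ V.1.snd W.1.snd := rfl
  have e1 : inner ℝ (der α V) (der α W) =
    inner ℝ ((√α)⁻¹ • V.1.snd) ((√α)⁻¹ • W.1.snd) := rfl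
  rw [e, e1, real_inner_smul_left, real_inner_smul_right]
  have h0 : 0 < √α := Real.sqrt_pos.2 hα.out
  have h2 : α = √α * √α := (Real.mul_self_sqrt hα.out.le).symm
  have h3 : α * ((√α)⁻¹ * ((√α)⁻¹ * inner ℝ V.1.snd W.1.snd)) = inner ℝ V.1.snd W.1.snd := by
    nth_rewrite 1 [h2]; field_simp
  rw [h3]; rfl

theorem norm_sq (W : EnergySpace α) : ‖W‖ ^ 2 = ‖val α W‖ ^ 2 + α * ‖der α W‖ ^ 2 := by
  simp only [← real_inner_self_eq_norm_sq, inner_def]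

theorem norm_val_le (W : EnergySpace α) : ‖val α W‖ ≤ ‖W‖ := by
  refine abs_le_of_sq_le_sq' ?_ (norm_nonneg _) |>.2
  rw [norm_sq]
  have := hα.out
  nlinarith [sq_nonneg ‖der α W‖]

/-- The element of the energy space with prescribed value and derivative. -/
def mk (v g : L2) (h : HasWeakDeriv v g) : EnergySpace α :=
  ⟨WithLp.toLp 2 (v, √α • g), by
    have h0 : √α ≠ 0 := (Real.sqrt_pos.2 hα.out).ne'
    change HasWeakDeriv v ((√α)⁻¹ • √α • g : L2)
    rwa [inv_smul_smul₀ h0]⟩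

@[simp] theorem val_mk (v g : L2) (h : HasWeakDeriv v g) : val α (mk v g h) = v := rfl

@[simp] theorem der_mk (v g : L2) (h : HasWeakDeriv v g) : der α (mk v g h) = g :=
  inv_smul_smul₀ (Real.sqrt_pos.2 hα.out).ne' g

/-- A test function as an element of the energy space. -/
def test (ψ : 𝓓((⊤ : Opens ℝ), ℝ)) : EnergySpace α :=
  mk (toL2 ψ) (toL2 (deriv ψ)) <|
    ((HasACDeriv.of_contDiff (ψ.contDiff.of_le (by simp))).hasWeakDeriv).congr
      (coeFn_toL2 (testFunction_memLp ψ)).symm (coeFn_toL2 (deriv_testFunction_memLp ψ)).symm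

@[simp] theorem val_test (ψ : 𝓓((⊤ : Opens ℝ), ℝ)) : val α (test ψ) = toL2 ψ := rfl

@[simp] theorem der_test (ψ : 𝓓((⊤ : Opens ℝ), ℝ)) : der α (test ψ) = toL2 (deriv ψ) :=
  der_mk ..

/-- Density of test functions without mollification: orthogonality to them says αW'' = W weakly, and
pairing this with W gives α‖W'‖² = -‖W‖². -/
theorem eq_zero_of_inner_test_eq_zero {W : EnergySpace α}
    (h : ∀ ψ : 𝓓((⊤ : Opens ℝ), ℝ), inner ℝ W (test ψ) = 0) : W = 0 := by
  have h1 : HasWeakDeriv (α • der α W : L2) (val α W) := hasWeakDeriv_iff.2 fun ψ => by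
    have := h ψ
    rw [inner_def, val_test, der_test] at this
    rw [real_inner_smul_left]
    linarith
  have h2 := h1.inner_eq_neg W.hasWeakDeriv
  rw [real_inner_smul_left, real_inner_self_eq_norm_sq, real_inner_self_eq_norm_sq] at h2
  have h3 := norm_sq W
  rw [← norm_eq_zero, ← sq_eq_zero_iff]
  linarith

/-! ### Properties of the resolvent operators -/

/-- Elliptic regularity, read off from the weak form: αV'' = V - h. -/
theorem hasWeakDeriv_der_res (h : L2) :
    HasWeakDeriv (der α (res α h)) (α⁻¹ • (val α (res α h) - h) : L2) := by
  have hα' : α ≠ 0 := hα.out.ne'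
  refine hasWeakDeriv_iff.2 fun ψ => ?_
  have := inner_res (α := α) h (test ψ)
  rw [inner_def, val_test, der_test] at this
  rw [real_inner_smul_left, inner_sub_left]
  field_simp
  linarith

theorem hasWeakDeriv_der_dres (h : L2) :
    HasWeakDeriv (α • der α (dres α h) - h : L2) (val α (dres α h)) := by
  refine hasWeakDeriv_iff.2 fun ψ => ?_
  have := inner_dres (α := α) h (test ψ)
  rw [inner_def, val_test, der_test] at this
  rw [inner_sub_left, real_inner_smul_left]
  linarith

/-- Differentiation commutes with the resolvent. The derivative of the solution lies in H¹ by
`hasWeakDeriv_der_res`, and it satisfies the weak equation that characterizes the right side. -/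
theorem der_res_val (W : EnergySpace α) : der α (res α (val α W)) = val α (res α (der α W)) := by
  have hα' : α ≠ 0 := hα.out.ne'
  have h1 := hasWeakDeriv_der_res (α := α) (val α W)
  rw [← val_mk (α := α) _ _ h1]
  congr 1
  refine eq_of_inner fun U => ?_
  rw [inner_res, inner_def, val_mk, der_mk, real_inner_smul_left, inner_sub_left,
    (res α (val α W)).hasWeakDeriv.inner_eq_neg U.hasWeakDeriv,
    W.hasWeakDeriv.inner_eq_neg U.hasWeakDeriv]
  field_simp
  ring

theorem der_dres_val (W : EnergySpace α) :
    der α (dres α (val α W)) = val α (dres α (der α W)) := by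
  have hα' : α ≠ 0 := hα.out.ne'
  have h1 : HasWeakDeriv (der α (dres α (val α W)))
      (α⁻¹ • (val α (dres α (val α W)) + der α W) : L2) := by
    have := ((hasWeakDeriv_der_dres (α := α) (val α W)).coe_add W.hasWeakDeriv).coe_smul α⁻¹
    rwa [sub_add_cancel, inv_smul_smul₀ hα'] at this
  rw [← val_mk (α := α) _ _ h1]
  congr 1
  refine eq_of_inner fun U => ?_
  rw [inner_dres, inner_def, val_mk, der_mk, real_inner_smul_left, inner_add_left,
    (dres α (val α W)).hasWeakDeriv.inner_eq_neg U.hasWeakDeriv]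
  field_simp
  ring

/-- This is -α∂²(1 - α∂²)⁻¹ = 1 - (1 - α∂²)⁻¹: the viscous term is a zeroth-order damping up to a
smoothing operator. -/
theorem smul_dres_der (W : EnergySpace α) : α • dres α (der α W) = W - res α (val α W) := by
  refine eq_of_inner fun U => ?_
  rw [inner_sub_left, inner_res, real_inner_smul_left, inner_dres, inner_def]
  ring

/-! ### The continuous representative -/

variable (α) in
/-- The norm of the embedding of the energy space into bounded continuous functions. -/
def supConst : ℝ := √((√α)⁻¹)

theorem abs_rep_le {W : EnergySpace α} {v' : ℝ → ℝ} (hv : val α W =ᵐ[volume] v')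
    (H : HasACDeriv v' (der α W)) (x : ℝ) : |v' x| ≤ supConst α * ‖W‖ := by
  refine abs_le_of_sq_le_sq ?_ (mul_nonneg (Real.sqrt_nonneg _) (norm_nonneg _))
  rw [supConst, mul_pow, Real.sq_sqrt (by positivity), norm_sq]
  exact (rep_sq_le hv H x).trans (two_mul_norm_le hα.out _ _)

/-- The continuous representative, as a bounded continuous function. -/
def repFun (W : EnergySpace α) : BoundedContinuousFunction ℝ ℝ :=
  BoundedContinuousFunction.ofNormedAddCommGroup (exists_rep W).choose
    (exists_rep W).choose_spec.2.continuous (supConst α * ‖W‖)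
    (abs_rep_le (exists_rep W).choose_spec.1 (exists_rep W).choose_spec.2)

theorem norm_repFun_le (W : EnergySpace α) : ‖repFun W‖ ≤ supConst α * ‖W‖ :=
  (BoundedContinuousFunction.norm_le (mul_nonneg (Real.sqrt_nonneg _) (norm_nonneg _))).2
    (abs_rep_le (exists_rep W).choose_spec.1 (exists_rep W).choose_spec.2)

theorem val_ae_repFun (W : EnergySpace α) : val α W =ᵐ[volume] repFun W :=
  (exists_rep W).choose_spec.1

theorem repFun_eq {W : EnergySpace α} {v : BoundedContinuousFunction ℝ ℝ}
    (h : val α W =ᵐ[volume] v) : repFun W = v := by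
  have := (val_ae_repFun W).symm.trans h
  exact DFunLike.coe_injective
    (((repFun W).continuous.ae_eq_iff_eq volume v.continuous).1 this)

variable (α) in
/-- The embedding of the energy space into bounded continuous functions. -/
def rep : EnergySpace α →L[ℝ] BoundedContinuousFunction ℝ ℝ :=
  LinearMap.mkContinuous
    { toFun := repFun
      map_add' := fun V W => repFun_eq <| by
        rw [map_add]
        filter_upwards [Lp.coeFn_add (val α V) (val α W), val_ae_repFun V, val_ae_repFun W]
          with x h1 h2 h3
        rw [h1, Pi.add_apply, h2, h3]; rfl
      map_smul' := fun c W => repFun_eq <| by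
        rw [map_smul]
        filter_upwards [Lp.coeFn_smul c (val α W), val_ae_repFun W] with x h1 h2
        rw [h1, Pi.smul_apply, h2]; rfl }
    (supConst α) norm_repFun_le

theorem val_ae_rep (W : EnergySpace α) : val α W =ᵐ[volume] rep α W := val_ae_repFun W

theorem rep_hasACDeriv (W : EnergySpace α) : HasACDeriv (rep α W) (der α W) :=
  (exists_rep W).choose_spec.2

theorem norm_rep_le (W : EnergySpace α) : ‖rep α W‖ ≤ supConst α * ‖W‖ :=
  norm_repFun_le W

theorem rep_apply_sq_le (W : EnergySpace α) (x : ℝ) :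
    rep α W x ^ 2 ≤ 2 * (‖val α W‖ * ‖der α W‖) :=
  rep_sq_le (val_ae_rep W) (rep_hasACDeriv W) x

/-- If the derivative of `V` is the value of `W`, then the representative of `V` is `C¹`. -/
theorem hasDerivAt_rep {V W : EnergySpace α} (h : der α V = val α W) (x : ℝ) :
    HasDerivAt (rep α V) (rep α W x) x := by
  have := (rep_hasACDeriv V).congr_deriv (h ▸ val_ae_rep W)
  exact this.hasDerivAt (rep α W).continuous x

end EnergySpace

/-! ### Multiplication and composition operators -/

/-- Multiplication of an `L²` function by a bounded continuous function. -/
def mulL : BoundedContinuousFunction ℝ ℝ →L[ℝ] L2 →L[ℝ] L2 :=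
  have hm : ∀ (b : BoundedContinuousFunction ℝ ℝ) (g : L2), MemLp (fun x => b x * g x) 2 volume :=
    fun b g => (Lp.memLp g).of_le_mul (c := ‖b‖)
      (b.continuous.aestronglyMeasurable.mul (Lp.aestronglyMeasurable g))
      (.of_forall fun x => by
        rw [norm_mul]; exact mul_le_mul_of_nonneg_right (b.norm_coe_le_norm x) (norm_nonneg _))
  LinearMap.mkContinuous₂
    (LinearMap.mk₂ ℝ (fun b g => toL2 fun x => b x * g x)
      (fun b c g => Lp.ext <| by
        filter_upwards [coeFn_toL2 (hm (b + c) g), coeFn_toL2 (hm b g), coeFn_toL2 (hm c g),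
          Lp.coeFn_add (toL2 fun x => b x * g x) (toL2 fun x => c x * g x)] with x h1 h2 h3 h4
        rw [h1, h4, Pi.add_apply, h2, h3]; simp [add_mul])
      (fun r b g => Lp.ext <| by
        filter_upwards [coeFn_toL2 (hm (r • b) g), coeFn_toL2 (hm b g),
          Lp.coeFn_smul r (toL2 fun x => b x * g x)] with x h1 h2 h4
        rw [h1, h4, Pi.smul_apply, h2]; simp [mul_assoc])
      (fun b g h => Lp.ext <| by
        filter_upwards [coeFn_toL2 (hm b (g + h)), coeFn_toL2 (hm b g), coeFn_toL2 (hm b h),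
          Lp.coeFn_add g h,
          Lp.coeFn_add (toL2 fun x => b x * g x) (toL2 fun x => b x * h x)] with x h1 h2 h3 h5 h4
        rw [h1, h4, Pi.add_apply, h2, h3, h5]; simp [mul_add])
      (fun r b g => Lp.ext <| by
        filter_upwards [coeFn_toL2 (hm b (r • g)), coeFn_toL2 (hm b g),
          Lp.coeFn_smul r g, Lp.coeFn_smul r (toL2 fun x => b x * g x)] with x h1 h2 h5 h4
        rw [h1, h4, Pi.smul_apply, h2, h5]; simp; ring))
    1 fun b g => by
      rw [one_mul]
      refine Lp.norm_le_mul_norm_of_ae_le_mul ?_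
      filter_upwards [coeFn_toL2 (hm b g)] with x hx
      simp only [LinearMap.mk₂_apply]
      rw [hx, norm_mul]
      exact mul_le_mul_of_nonneg_right (b.norm_coe_le_norm x) (norm_nonneg _)

theorem coeFn_mulL (b : BoundedContinuousFunction ℝ ℝ) (g : L2) :
    mulL b g =ᵐ[volume] fun x => b x * g x := by
  refine coeFn_toL2 ((Lp.memLp g).of_le_mul (c := ‖b‖)
      (b.continuous.aestronglyMeasurable.mul (Lp.aestronglyMeasurable g))
      (.of_forall fun x => ?_))
  rw [norm_mul]; exact mul_le_mul_of_nonneg_right (b.norm_coe_le_norm x) (norm_nonneg _)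

theorem norm_mulL_le_of_forall {b : BoundedContinuousFunction ℝ ℝ} {C : ℝ}
    (h : ∀ x, |b x| ≤ C) (g : L2) : ‖mulL b g‖ ≤ C * ‖g‖ := by
  refine Lp.norm_le_mul_norm_of_ae_le_mul ?_
  filter_upwards [coeFn_mulL b g] with x hx
  rw [hx, norm_mul]
  exact mul_le_mul_of_nonneg_right (h x) (norm_nonneg _)

/-- A continuous function of compact support as a bounded continuous function. -/
def bddOfCompact (G : ℝ → ℝ) (h : Continuous G) (hc : HasCompactSupport G) :
    BoundedContinuousFunction ℝ ℝ :=
  BoundedContinuousFunction.ofNormedAddCommGroup G h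
    (h.bounded_above_of_compact_support hc).choose
    (h.bounded_above_of_compact_support hc).choose_spec

/-- Uniform continuity of G carries uniform convergence of b to uniform convergence of G ∘ b. -/
theorem continuous_compContinuous {G : BoundedContinuousFunction ℝ ℝ} (hG : UniformContinuous G) :
    Continuous fun b : BoundedContinuousFunction ℝ ℝ => G.compContinuous b.toContinuousMap := by
  refine continuous_iff_continuousAt.2 fun b => ?_
  refine BoundedContinuousFunction.tendsto_iff_tendstoUniformly.2 ?_
  exact hG.comp_tendstoUniformly
    (BoundedContinuousFunction.tendsto_iff_tendstoUniformly.1 tendsto_id)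

/-- A `C²` function of compact support that vanishes at the origin. -/
structure CutoffFlux (F : ℝ → ℝ) : Prop where
  contDiff : ContDiff ℝ 2 F
  map_zero : F 0 = 0
  compact : HasCompactSupport F

namespace CutoffFlux

variable {F : ℝ → ℝ} (hF : CutoffFlux F)

include hF

theorem contDiff_deriv : ContDiff ℝ 1 (deriv F) :=
  (contDiff_succ_iff_deriv (n := 1).1 hF.contDiff).2.2

theorem continuous_deriv_deriv : Continuous (deriv (deriv F)) :=
  hF.contDiff_deriv.continuous_deriv le_rfl

theorem exists_lipschitzWith : ∃ K, LipschitzWith K F :=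
  (hF.contDiff.of_le one_le_two).lipschitzWith_of_hasCompactSupport hF.compact one_ne_zero

theorem exists_lipschitzWith_deriv : ∃ K, LipschitzWith K (deriv F) :=
  hF.contDiff_deriv.lipschitzWith_of_hasCompactSupport hF.compact.deriv one_ne_zero

/-- A Lipschitz constant of the flux. -/
def lip : NNReal := hF.exists_lipschitzWith.choose

/-- A Lipschitz constant of the derivative of the flux. -/
def lip' : NNReal := hF.exists_lipschitzWith_deriv.choose

theorem lipschitzWith : LipschitzWith hF.lip F := hF.exists_lipschitzWith.choose_spec

theorem lipschitzWith_deriv : LipschitzWith hF.lip' (deriv F) :=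
  hF.exists_lipschitzWith_deriv.choose_spec

theorem abs_deriv_le (s : ℝ) : |deriv F s| ≤ hF.lip := norm_deriv_le_of_lipschitz hF.lipschitzWith

theorem abs_deriv_deriv_le (s : ℝ) : |deriv (deriv F) s| ≤ hF.lip' :=
  norm_deriv_le_of_lipschitz hF.lipschitzWith_deriv

theorem abs_le (s : ℝ) : |F s| ≤ hF.lip * |s| := by
  simpa [hF.map_zero] using hF.lipschitzWith.dist_le_mul s 0

/-- The Nemytskii operator `v ↦ F(v)` on `L²`. -/
def nem (v : L2) : L2 := hF.lipschitzWith.compLp hF.map_zero v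

theorem coeFn_nem (v : L2) : hF.nem v =ᵐ[volume] fun x => F (v x) :=
  hF.lipschitzWith.coeFn_compLp hF.map_zero v

theorem lipschitzWith_nem : LipschitzWith hF.lip hF.nem :=
  hF.lipschitzWith.lipschitzWith_compLp hF.map_zero

/-- Composition with `F'`, on bounded continuous functions. -/
def comp' (b : BoundedContinuousFunction ℝ ℝ) : BoundedContinuousFunction ℝ ℝ :=
  (bddOfCompact (deriv F) hF.contDiff_deriv.continuous hF.compact.deriv).compContinuous
    b.toContinuousMap

/-- Composition with `F''`, on bounded continuous functions. -/
def comp'' (b : BoundedContinuousFunction ℝ ℝ) : BoundedContinuousFunction ℝ ℝ :=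
  (bddOfCompact (deriv (deriv F)) hF.continuous_deriv_deriv hF.compact.deriv.deriv).compContinuous
    b.toContinuousMap

@[simp] theorem comp'_apply (b : BoundedContinuousFunction ℝ ℝ) (x : ℝ) :
    hF.comp' b x = deriv F (b x) := rfl

@[simp] theorem comp''_apply (b : BoundedContinuousFunction ℝ ℝ) (x : ℝ) :
    hF.comp'' b x = deriv (deriv F) (b x) := rfl

theorem continuous_comp' : Continuous hF.comp' :=
  continuous_compContinuous
    (hF.compact.deriv.uniformContinuous_of_continuous hF.contDiff_deriv.continuous)

theorem continuous_comp'' : Continuous hF.comp'' :=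
  continuous_compContinuous
    (hF.compact.deriv.deriv.uniformContinuous_of_continuous hF.continuous_deriv_deriv)

variable {α : ℝ} [hα : Fact (0 < α)]

open EnergySpace

/-- The first derivative of `F(w)`. -/
def nem' (W : EnergySpace α) : L2 := mulL (hF.comp' (rep α W)) (der α W)

/-- The second derivative of `F(w)`, for `V` the derivative of `W`. -/
def nem'' (W V : EnergySpace α) : L2 :=
  mulL (hF.comp'' (rep α W)) (mulL (rep α V) (val α V)) + mulL (hF.comp' (rep α W)) (der α V)

theorem continuous_nem' : Continuous (hF.nem' (α := α)) := by
  have h := hF.continuous_comp'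
  unfold nem'
  fun_prop

theorem continuous_nem'' {W V : ℝ → EnergySpace α} (hW : Continuous W) (hV : Continuous V) :
    Continuous fun t => hF.nem'' (W t) (V t) := by
  have h := hF.continuous_comp'
  have h' := hF.continuous_comp''
  unfold nem''
  fun_prop

theorem norm_nem'_le (W : EnergySpace α) : ‖hF.nem' W‖ ≤ hF.lip * ‖der α W‖ :=
  norm_mulL_le_of_forall (fun _ => hF.abs_deriv_le _) _

theorem norm_nem''_le (W V : EnergySpace α) :
    ‖hF.nem'' W V‖ ≤ hF.lip' * (‖rep α V‖ * ‖val α V‖) + hF.lip * ‖der α V‖ := by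
  refine (norm_add_le _ _).trans (add_le_add ?_ ?_)
  · refine (norm_mulL_le_of_forall (fun _ => hF.abs_deriv_deriv_le _) _).trans ?_
    gcongr
    exact norm_mulL_le_of_forall (fun x => (rep α V).norm_coe_le_norm x) _
  · exact norm_mulL_le_of_forall (fun _ => hF.abs_deriv_le _) _

theorem hasWeakDeriv_nem (W : EnergySpace α) : HasWeakDeriv (hF.nem (val α W)) (hF.nem' W) := by
  have := ((rep_hasACDeriv W).comp (hF.contDiff.of_le one_le_two)).hasWeakDeriv
  refine this.congr ?_ (coeFn_mulL (hF.comp' (rep α W)) (der α W)).symm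
  filter_upwards [hF.coeFn_nem (val α W), val_ae_rep W] with x h1 h2
  rw [h1, h2]

theorem hasWeakDeriv_nem' {W V : EnergySpace α} (h : der α W = val α V) :
    HasWeakDeriv (hF.nem' W) (hF.nem'' W V) := by
  have h1 := (rep_hasACDeriv W).comp hF.contDiff_deriv
  refine (h1.mul (rep_hasACDeriv V)).hasWeakDeriv.congr ?_ ?_
  · filter_upwards [coeFn_mulL (hF.comp' (rep α W)) (der α W), val_ae_rep V] with x h1 h2
    rw [nem', h1, h, h2]; rfl
  · filter_upwards [coeFn_mulL (hF.comp'' (rep α W)) (mulL (rep α V) (val α V)),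
      coeFn_mulL (rep α V) (val α V), coeFn_mulL (hF.comp' (rep α W)) (der α V), val_ae_rep V,
      Lp.coeFn_add (mulL (hF.comp'' (rep α W)) (mulL (rep α V) (val α V)))
        (mulL (hF.comp' (rep α W)) (der α V))] with x h1 h2 h3 h4 h5
    rw [nem'', h5, Pi.add_apply, h1, h2, h3, h, h4]
    simp only [comp'_apply, comp''_apply]
    ring

/-- The flux does not contribute to the energy balance. -/
theorem inner_nem_der (W : EnergySpace α) : inner ℝ (hF.nem (val α W)) (der α W) = 0 := by
  have hFc : Continuous F := hF.contDiff.continuous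
  -- With Φ the primitive of F, F(w) w' is the derivative of Φ(w). The bound |Φ(s)| ≤ `lip` s² makes
  -- Φ(w) integrable, so its derivative has integral zero.
  set Φ : ℝ → ℝ := fun s => ∫ t in (0 : ℝ)..s, F t with hΦ
  have hΦd : ∀ s, HasDerivAt Φ (F s) s := fun s =>
    intervalIntegral.integral_hasDerivAt_right (hFc.intervalIntegrable _ _)
      (hFc.stronglyMeasurableAtFilter _ _) hFc.continuousAt
  have hΦ' : deriv Φ = F := funext fun s => (hΦd s).deriv
  have hΦc : ContDiff ℝ 1 Φ :=
    contDiff_one_iff_deriv.2 ⟨fun s => (hΦd s).differentiableAt, hΦ' ▸ hFc⟩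
  have hΦle : ∀ s, |Φ s| ≤ hF.lip * (s * s) := fun s => by
    have := intervalIntegral.norm_integral_le_of_norm_le_const (a := 0) (b := s) (f := F)
      (C := hF.lip * |s|) fun t ht => by
        refine (hF.abs_le t).trans ?_
        refine mul_le_mul_of_nonneg_left ?_ (NNReal.coe_nonneg _)
        have := abs_sub_left_of_mem_uIcc (uIoc_subset_uIcc ht)
        simpa using this
    rw [sub_zero, mul_assoc, abs_mul_abs_self] at this
    exact this
  have H := (rep_hasACDeriv W).comp hΦc
  rw [hΦ'] at H
  have e : ∫ x, F (rep α W x) * der α W x = inner ℝ (hF.nem (val α W)) (der α W) := by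
    rw [L2.inner_eq]
    refine integral_congr_ae ?_
    filter_upwards [hF.coeFn_nem (val α W), val_ae_rep W] with x h1 h2
    rw [h1, h2]
  rw [← e]
  refine H.integral_eq_zero ?_ ?_
  · refine (((L2.integrable_mul (val α W) (val α W)).const_mul hF.lip).mono'
      (hΦc.continuous.comp (rep α W).continuous).aestronglyMeasurable ?_)
    filter_upwards [val_ae_rep W] with x h2
    rw [h2]; exact hΦle _
  · refine (L2.integrable_mul (hF.nem (val α W)) (der α W)).congr ?_
    filter_upwards [hF.coeFn_nem (val α W), val_ae_rep W] with x h1 h2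
    rw [h1, h2]

end CutoffFlux

/-! ### Ordinary differential equations in Banach spaces -/

section ODE

variable {E H : Type*} [NormedAddCommGroup E] [NormedSpace ℝ E]
  [NormedAddCommGroup H] [NormedSpace ℝ H]

theorem norm_integral_le_exp {f : ℝ → E} {C l : ℝ} (hl : 0 < l)
    (h : ∀ s, ‖f s‖ ≤ C * Real.exp (l * |s|)) (t : ℝ) :
    ‖∫ s in (0 : ℝ)..t, f s‖ ≤ C / l * Real.exp (l * |t|) := by
  have hC : 0 ≤ C := by
    have := (norm_nonneg _).trans (h 0)
    simpa using this
  have key : ∀ f : ℝ → E, (∀ s, ‖f s‖ ≤ C * Real.exp (l * |s|)) → ∀ t, 0 ≤ t →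
      ‖∫ s in (0 : ℝ)..t, f s‖ ≤ C / l * Real.exp (l * t) := by
    intro f h t ht
    have h1 : ‖∫ s in (0 : ℝ)..t, f s‖ ≤ ∫ s in (0 : ℝ)..t, C * Real.exp (l * s) := by
      refine intervalIntegral.norm_integral_le_of_norm_le ht (.of_forall fun s hs => ?_)
        (Continuous.intervalIntegrable (by fun_prop) _ _)
      simpa [abs_of_pos hs.1] using h s
    have h2 : ∫ s in (0 : ℝ)..t, C * Real.exp (l * s) = C / l * (Real.exp (l * t) - 1) := by
      rw [intervalIntegral.integral_const_mul, intervalIntegral.integral_comp_mul_left _ hl.ne',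
        integral_exp]
      simp; ring
    refine (h1.trans_eq h2).trans ?_
    gcongr
    linarith
  rcases le_total 0 t with ht | ht
  · rw [abs_of_nonneg ht]; exact key f h t ht
  · have h1 := key (fun s => f (-s)) (fun s => by simpa using h (-s)) (-t) (by linarith)
    rw [intervalIntegral.integral_comp_neg, neg_zero, neg_neg, intervalIntegral.integral_symm,
      norm_neg] at h1
    rwa [abs_of_nonpos ht]

variable [CompleteSpace E]

/-- Global solvability of autonomous equations with a Lipschitz right-hand side. -/
theorem exists_global_solution {N : E → E} {K : NNReal} (hN : LipschitzWith K N) (x₀ : E) :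
    ∃ x : ℝ → E, x 0 = x₀ ∧ ∀ t, HasDerivAt x (N (x t)) t := by
  -- The exponential weight turns K into K / l ≤ 1/2; the + 1 keeps l positive when K = 0.
  set l : ℝ := 2 * K + 1 with hl
  have hl0 : 0 < l := by positivity
  let e : ℝ → ℝ := fun t => Real.exp (l * |t|)
  have he : Continuous e := by fun_prop
  have he1 : ∀ t, 1 ≤ e t := fun t => Real.one_le_exp (by positivity)
  have he0 : ∀ t, 0 < e t := fun t => Real.exp_pos _
  have hNc : ∀ z : BoundedContinuousFunction ℝ E, Continuous fun s => N (e s • z s) := fun z =>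
    hN.continuous.comp (he.smul z.continuous)
  have hNb : ∀ (z : BoundedContinuousFunction ℝ E) (s : ℝ),
      ‖N (e s • z s)‖ ≤ (‖N 0‖ + K * ‖z‖) * Real.exp (l * |s|) := fun z s => by
    have h1 : ‖N (e s • z s) - N 0‖ ≤ K * (e s * ‖z‖) := by
      have := hN.norm_sub_le (e s • z s) 0
      rw [sub_zero, norm_smul, Real.norm_of_nonneg (he0 s).le] at this
      refine this.trans ?_
      gcongr
      exact z.norm_coe_le_norm s
    have h2 : ‖N (e s • z s)‖ ≤ ‖N (e s • z s) - N 0‖ + ‖N 0‖ := by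
      simpa using norm_add_le (N (e s • z s) - N 0) (N 0)
    have h3 : ‖N 0‖ ≤ ‖N 0‖ * e s := le_mul_of_one_le_right (norm_nonneg _) (he1 s)
    change _ ≤ _ * e s
    linarith
  have hint : ∀ z : BoundedContinuousFunction ℝ E,
      Continuous fun t => ∫ s in (0 : ℝ)..t, N (e s • z s) := fun z =>
    intervalIntegral.continuous_primitive (fun a b => (hNc z).intervalIntegrable _ _) 0
  -- The unknown is z = x / e, so the sup norm of z is a weighted norm of x. A single fixed point is
  -- then global in both time directions.
  let P : BoundedContinuousFunction ℝ E → BoundedContinuousFunction ℝ E := fun z =>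
    BoundedContinuousFunction.ofNormedAddCommGroup
      (fun t => (e t)⁻¹ • (x₀ + ∫ s in (0 : ℝ)..t, N (e s • z s)))
      ((he.inv₀ fun t => (he0 t).ne').smul (continuous_const.add (hint z)))
      (‖x₀‖ + (‖N 0‖ + K * ‖z‖) / l) fun t => by
        rw [norm_smul, norm_inv, Real.norm_of_nonneg (he0 t).le, inv_mul_le_iff₀ (he0 t)]
        have h1 := norm_integral_le_exp hl0 (hNb z) t
        have h2 := norm_add_le x₀ (∫ s in (0 : ℝ)..t, N (e s • z s))
        have h3 : ‖x₀‖ ≤ e t * ‖x₀‖ := le_mul_of_one_le_left (norm_nonneg _) (he1 t)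
        change _ ≤ _ * e t at h1
        linarith
  have hPz : ∀ z t, P z t = (e t)⁻¹ • (x₀ + ∫ s in (0 : ℝ)..t, N (e s • z s)) := fun _ _ => rfl
  have hP : ContractingWith (1 / 2) P := by
    refine ⟨by rw [← NNReal.coe_lt_coe]; norm_num, LipschitzWith.of_dist_le_mul fun z y => ?_⟩
    refine (BoundedContinuousFunction.dist_le (by positivity)).2 fun t => ?_
    have e1 : P z t - P y t = (e t)⁻¹ • ∫ s in (0 : ℝ)..t, (N (e s • z s) - N (e s • y s)) := by
      rw [intervalIntegral.integral_sub ((hNc z).intervalIntegrable _ _)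
        ((hNc y).intervalIntegrable _ _)]
      rw [hPz, hPz, ← smul_sub, add_sub_add_left_eq_sub]
    rw [dist_eq_norm, e1, norm_smul, norm_inv, Real.norm_of_nonneg (he0 t).le,
      inv_mul_le_iff₀ (he0 t)]
    have h1 := norm_integral_le_exp (f := fun s => N (e s • z s) - N (e s • y s))
      (C := K * dist z y) hl0 (fun s => by
        refine (hN.norm_sub_le _ _).trans ?_
        rw [← smul_sub, norm_smul, Real.norm_of_nonneg (he0 s).le, ← dist_eq_norm, mul_assoc,
          mul_comm (e s)]
        gcongr
        exact BoundedContinuousFunction.dist_coe_le_dist s) t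
    refine h1.trans ?_
    rw [mul_comm]
    change e t * _ ≤ _
    gcongr
    rw [div_le_iff₀ hl0]
    have : 0 ≤ dist z y := dist_nonneg
    simp only [NNReal.coe_div, NNReal.coe_one, NNReal.coe_ofNat, hl]
    nlinarith
  obtain ⟨z, hz⟩ : ∃ z, P z = z := ⟨_, hP.fixedPoint_isFixedPt⟩
  have hx : ∀ t, e t • z t = x₀ + ∫ s in (0 : ℝ)..t, N (e s • z s) := fun t => by
    have : z t = (e t)⁻¹ • (x₀ + ∫ s in (0 : ℝ)..t, N (e s • z s)) := by
      conv_lhs => rw [← hz]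
      exact hPz z t
    rw [this, smul_inv_smul₀ (he0 t).ne']
  refine ⟨fun t => e t • z t, ?_, fun t => ?_⟩
  · simp only [hx 0, intervalIntegral.integral_same, add_zero]
  · have h1 : HasDerivAt (fun t => ∫ s in (0 : ℝ)..t, N (e s • z s)) (N (e t • z t)) t :=
      intervalIntegral.integral_hasDerivAt_right ((hNc z).intervalIntegrable _ _)
        ((hNc z).stronglyMeasurableAtFilter _ _) (hNc z).continuousAt
    have h2 := h1.const_add x₀
    have e2 : (fun t => e t • z t) = fun t => x₀ + ∫ s in (0 : ℝ)..t, N (e s • z s) :=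
      funext hx
    rw [← e2] at h2
    exact h2

/-- A solution of `y' = -γ y + i η` in `H` with data in the image of `i : E → H` is the image of
a solution in `E`. -/
theorem exists_lift_solution (i : E →L[ℝ] H) {γ : ℝ} {y : ℝ → H} {η : ℝ → E}
    (hη : Continuous η) (hy : ∀ t, HasDerivAt y (-(γ • y t) + i (η t)) t) {x₀ : E}
    (h0 : i x₀ = y 0) :
    ∃ x : ℝ → E, x 0 = x₀ ∧ (∀ t, HasDerivAt x (-(γ • x t) + η t) t) ∧ ∀ t, i (x t) = y t := by
  have hexp : ∀ c t : ℝ, HasDerivAt (fun t => Real.exp (c * t)) (Real.exp (c * t) * c) t :=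
    fun c t => by simpa using ((hasDerivAt_id t).const_mul c).exp
  have hc : Continuous fun s => Real.exp (γ * s) • η s := by fun_prop
  -- Duhamel's formula, evaluated in the smaller space E. That i x agrees with y follows because
  -- exp(γt)(y - i x) has zero derivative.
  let x : ℝ → E := fun t =>
    Real.exp (-γ * t) • (x₀ + ∫ s in (0 : ℝ)..t, Real.exp (γ * s) • η s)
  have hx : ∀ t, HasDerivAt x (-(γ • x t) + η t) t := fun t => by
    have h1 : HasDerivAt (fun t => ∫ s in (0 : ℝ)..t, Real.exp (γ * s) • η s)
        (Real.exp (γ * t) • η t) t :=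
      intervalIntegral.integral_hasDerivAt_right (hc.intervalIntegrable _ _)
        (hc.stronglyMeasurableAtFilter _ _) hc.continuousAt
    refine ((hexp (-γ) t).smul (h1.const_add x₀)).congr_deriv ?_
    rw [smul_smul, ← Real.exp_add, add_comm]
    simp only [x, smul_smul, neg_mul, neg_add_cancel, Real.exp_zero, one_smul, mul_neg, neg_smul]
    rw [mul_comm _ γ]
  have hx0 : x 0 = x₀ := by simp [x]
  clear_value x
  refine ⟨x, hx0, hx, fun t => ?_⟩
  let d : ℝ → H := fun t => Real.exp (γ * t) • (y t - i (x t))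
  have hd : ∀ t, HasDerivAt d 0 t := fun t => by
    have h1 : HasDerivAt (fun t => i (x t)) (i (-(γ • x t) + η t)) t :=
      i.hasFDerivAt.comp_hasDerivAt t (hx t)
    refine ((hexp γ t).smul ((hy t).sub h1)).congr_deriv ?_
    simp only [map_add, map_neg, map_smul, mul_smul, Pi.sub_apply]
    module
  have := is_const_of_deriv_eq_zero (fun t => (hd t).differentiableAt)
    (fun t => (hd t).deriv) t 0
  simp only [d, hx0, h0, sub_self, smul_zero] at this
  rcases smul_eq_zero.1 this with h | h
  · exact absurd h (Real.exp_ne_zero _)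
  · exact (sub_eq_zero.1 h).symm

end ODE

/-! ### Energy inequality and decay of curves in time -/

/-- The basic dissipation estimate. -/
theorem dissipation_estimate {e e' p q : ℝ → ℝ} {a : ℝ} (ha : 0 < a)
    (he : ∀ t, HasDerivAt e (e' t) t) (he0 : ∀ t, 0 ≤ e t) (hp : Continuous p)
    (hp0 : ∀ t, 0 ≤ p t) (hq : Continuous q) (hq0 : ∀ t, 0 ≤ q t)
    (hqi : IntegrableOn q (Ioi 0)) (h : ∀ t, 0 ≤ t → e' t ≤ -(a * p t) + q t) :
    (∀ t, 0 ≤ t → e t ≤ e 0 + ∫ s in Ioi (0 : ℝ), q s) ∧ IntegrableOn p (Ioi 0) := by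
  have hc : Continuous fun s => a * p s - q s := by fun_prop
  have hder : ∀ t, HasDerivAt (fun t => e t + ∫ s in (0 : ℝ)..t, (a * p s - q s))
      (e' t + (a * p t - q t)) t := fun t =>
    (he t).add (intervalIntegral.integral_hasDerivAt_right (hc.intervalIntegrable _ _)
        (hc.stronglyMeasurableAtFilter _ _) hc.continuousAt)
  -- The differential inequality says exactly that this corrected energy is nonincreasing, which
  -- yields the bound on e and on ∫ p at once.
  have hanti : AntitoneOn (fun t => e t + ∫ s in (0 : ℝ)..t, (a * p s - q s)) (Ici 0) := by
    refine antitoneOn_of_deriv_nonpos (convex_Ici 0)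
      (fun t _ => (hder t).continuousAt.continuousWithinAt)
      (fun t _ => (hder t).differentiableAt.differentiableWithinAt) fun t ht => ?_
    rw [interior_Ici] at ht
    rw [(hder t).deriv]
    linarith [h t (le_of_lt ht)]
  have key : ∀ t, 0 ≤ t →
      e t + a * (∫ s in (0 : ℝ)..t, p s) ≤ e 0 + ∫ s in Ioi (0 : ℝ), q s := fun t ht => by
    have h1 := hanti self_mem_Ici ht ht
    simp only [intervalIntegral.integral_same, add_zero] at h1
    rw [intervalIntegral.integral_sub ((hp.const_mul a).intervalIntegrable _ _)
      (hq.intervalIntegrable _ _), intervalIntegral.integral_const_mul] at h1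
    have h2 : ∫ s in (0 : ℝ)..t, q s ≤ ∫ s in Ioi (0 : ℝ), q s := by
      rw [intervalIntegral.integral_of_le ht]
      exact setIntegral_mono_set hqi (.of_forall hq0) Ioc_subset_Ioi_self.eventuallyLE
    linarith
  refine ⟨fun t ht => ?_, ?_⟩
  · have h1 : 0 ≤ ∫ s in (0 : ℝ)..t, p s := intervalIntegral.integral_nonneg ht fun s _ => hp0 s
    nlinarith [key t ht]
  · refine integrableOn_Ioi_of_intervalIntegral_norm_bounded (l := atTop) (b := id)
      ((e 0 + ∫ s in Ioi (0 : ℝ), q s) / a) 0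
      (fun t => (hp.integrableOn_Icc).mono_set Ioc_subset_Icc_self) tendsto_id ?_
    filter_upwards [eventually_ge_atTop 0] with t ht
    rw [le_div_iff₀ ha]
    simp only [Real.norm_of_nonneg (hp0 _), id]
    linarith [key t ht, he0 t]

/-- A square integrable curve with square integrable derivative tends to zero. -/
theorem tendsto_norm_zero_of_sq_integrable {E : Type*} [NormedAddCommGroup E]
    [InnerProductSpace ℝ E] {x x' : ℝ → E} (hx : ∀ t, HasDerivAt x (x' t) t)
    (hx' : Continuous x') (i : IntegrableOn (fun t => ‖x t‖ ^ 2) (Ioi 0))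
    (i' : IntegrableOn (fun t => ‖x' t‖ ^ 2) (Ioi 0)) :
    Tendsto (fun t => ‖x t‖) atTop (𝓝 0) := by
  have hd : ∀ t, HasDerivAt (fun t => ‖x t‖ ^ 2) (2 * inner ℝ (x t) (x' t)) t := fun t =>
    (hx t).norm_sq
  have hc : Continuous x := continuous_iff_continuousAt.2 fun t => (hx t).continuousAt
  -- The derivative of ‖x‖² is dominated by ‖x‖² + ‖x'‖²; an integrable function with integrable
  -- derivative tends to zero.
  have id : IntegrableOn (fun t => 2 * inner ℝ (x t) (x' t)) (Ioi 0) := by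
    refine Integrable.mono' (i.add i') (Continuous.aestronglyMeasurable (by fun_prop))
      (.of_forall fun t => ?_)
    rw [norm_mul, Real.norm_two]
    have := norm_inner_le_norm (𝕜 := ℝ) (x t) (x' t)
    simp only [Pi.add_apply]
    nlinarith [sq_nonneg (‖x t‖ - ‖x' t‖)]
  have := tendsto_zero_of_hasDerivAt_of_integrableOn_Ioi (fun t _ => hd t) id i
  simpa [Real.sqrt_sq (norm_nonneg _)] using this.sqrt

/-! ### The evolution equation in the energy space -/

theorem integrableOn_norm_sq_clm {E H : Type*} [NormedAddCommGroup E] [NormedSpace ℝ E]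
    [NormedAddCommGroup H] [NormedSpace ℝ H] (L : E →L[ℝ] H) {x : ℝ → E} (hx : Continuous x)
    (h : IntegrableOn (fun t => ‖x t‖ ^ 2) (Ioi 0)) :
    IntegrableOn (fun t => ‖L (x t)‖ ^ 2) (Ioi 0) := by
  refine Integrable.mono' (h.const_mul (‖L‖ ^ 2))
    (Continuous.aestronglyMeasurable (by fun_prop)) (.of_forall fun t => ?_)
  rw [Real.norm_of_nonneg (by positivity), ← mul_pow]
  have := L.le_opNorm (x t)
  gcongr

theorem integrableOn_norm_sq_sub {H : Type*} [NormedAddCommGroup H] [NormedSpace ℝ H]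
    {x y : ℝ → H} (hx : Continuous x) (hy : Continuous y) (c : ℝ)
    (h : IntegrableOn (fun t => ‖x t‖ ^ 2) (Ioi 0))
    (h' : IntegrableOn (fun t => ‖y t‖ ^ 2) (Ioi 0)) :
    IntegrableOn (fun t => ‖x t - c • y t‖ ^ 2) (Ioi 0) := by
  refine Integrable.mono' ((h.const_mul 2).add (h'.const_mul (2 * c ^ 2)))
    (Continuous.aestronglyMeasurable (by fun_prop)) (.of_forall fun t => ?_)
  rw [Real.norm_of_nonneg (by positivity)]
  have h1 : ‖x t - c • y t‖ ≤ ‖x t‖ + |c| * ‖y t‖ := by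
    simpa [norm_smul] using norm_sub_le (x t) (c • y t)
  calc ‖x t - c • y t‖ ^ 2 ≤ (‖x t‖ + |c| * ‖y t‖) ^ 2 := by gcongr
    _ ≤ 2 * (‖x t‖ ^ 2 + (|c| * ‖y t‖) ^ 2) := add_sq_le
    _ = _ := by rw [mul_pow, sq_abs]; simp only [Pi.add_apply]; ring

/-- Young's inequality: half of the dissipation absorbs the forcing. -/
theorem two_mul_inner_le (hβ : 0 < β) (h g : L2) :
    2 * inner ℝ h g - 2 * β * ‖g‖ ^ 2 ≤ -(β * ‖g‖ ^ 2) + ‖h‖ ^ 2 / β := by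
  have h1 := real_inner_le_norm h g
  have h2 : 2 * (‖h‖ * ‖g‖) ≤ β * ‖g‖ ^ 2 + ‖h‖ ^ 2 / β := by
    have : ‖h‖ ^ 2 / β - 2 * (‖h‖ * ‖g‖) + β * ‖g‖ ^ 2 = (‖h‖ - β * ‖g‖) ^ 2 / β := by
      field_simp
      ring
    have h3 : 0 ≤ (‖h‖ - β * ‖g‖) ^ 2 / β := by positivity
    linarith
  linarith

namespace EnergySpace

variable {α β : ℝ}

/-- In the energy inner product `dres` is the adjoint of the derivative, so pairing with W removes
the resolvent. -/
theorem hasDerivAt_norm_sq {W : ℝ → EnergySpace α} {h : L2} {t : ℝ}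
    (hW : HasDerivAt W (dres α (h - β • der α (W t))) t) :
    HasDerivAt (fun t => ‖W t‖ ^ 2)
      (2 * inner ℝ h (der α (W t)) - 2 * β * ‖der α (W t)‖ ^ 2) t := by
  refine hW.norm_sq.congr_deriv ?_
  rw [real_inner_comm, inner_dres, inner_sub_left, real_inner_smul_left,
    real_inner_self_eq_norm_sq]
  ring

variable [hα : Fact (0 < α)]

/-- The derivative in `x` of a solution of the linear equation is a solution of the differentiated
equation. -/
theorem exists_derivative_solution {W : ℝ → EnergySpace α}
    {h h' : ℝ → L2} (hW : ∀ t, HasDerivAt W (dres α (h t - β • der α (W t))) t)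
    (hh : ∀ t, HasWeakDeriv (h t) (h' t)) (hc : Continuous h') {V₀ : EnergySpace α}
    (h0 : der α (W 0) = val α V₀) :
    ∃ V : ℝ → EnergySpace α, V 0 = V₀ ∧ (∀ t, der α (W t) = val α (V t)) ∧
      ∀ t, HasDerivAt V (dres α (h' t - β • der α (V t))) t := by
  have hα0 : α ≠ 0 := hα.out.ne'
  have hWc : Continuous W := continuous_iff_continuousAt.2 fun t => (hW t).continuousAt
  have hd : ∀ U : EnergySpace α, β • dres α (der α U) = (β / α) • U - (β / α) • res α (val α U) := by
    intro U
    rw [← smul_sub, ← smul_dres_der, smul_smul, div_mul_cancel₀ _ hα0]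
  -- The derivative of W satisfies in L² a damped equation at rate β/α whose forcing is the image of
  -- a curve in H¹; this is the form that `exists_lift_solution` needs.
  have hy : ∀ t, HasDerivAt (fun t => der α (W t)) (-((β / α) • der α (W t)) +
      val α ((β / α) • res α (der α (W t)) + dres α (h' t))) t := fun t => by
    have h1 := (der α).hasFDerivAt.comp_hasDerivAt t (hW t)
    refine h1.congr_deriv ?_
    have h2 := der_dres_val (EnergySpace.mk (α := α) _ _ (hh t))
    rw [val_mk, der_mk] at h2
    rw [map_sub, map_smul, hd, map_sub, map_sub, map_smul, map_smul, der_res_val, h2, map_add,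
      map_smul]
    abel
  obtain ⟨V, hV0, hV, hVW⟩ := exists_lift_solution (val α) (by fun_prop) hy h0.symm
  refine ⟨V, hV0, fun t => (hVW t).symm, fun t => (hV t).congr_deriv ?_⟩
  rw [map_sub, map_smul, hd, hVW t]
  abel

end EnergySpace

/-! ### The flow of the truncated equation and its energy estimates -/

namespace CutoffFlux

open EnergySpace

variable {F : ℝ → ℝ} (hF : CutoffFlux F) {α : ℝ} {β : ℝ}

/-- The right-hand side of the evolution equation
`∂_t W = (1 - α ∂²)⁻¹ (β ∂² W - ∂ F(W))`. -/
def field (β : ℝ) (W : EnergySpace α) : EnergySpace α :=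
  dres α (hF.nem (val α W) - β • der α W)

theorem exists_lipschitzWith_field (β : ℝ) : ∃ K, LipschitzWith K (hF.field (α := α) β) :=
  ⟨_, (dres α).lipschitz.comp
    ((hF.lipschitzWith_nem.comp (val α).lipschitz).sub (β • der α).lipschitz)⟩

variable [hα : Fact (0 < α)]

/-- Moves the derivative onto the flux: F(w)' inherits square integrability in time from w_x, while
no such bound is available for F(w). -/
theorem field_eq (β : ℝ) (W : EnergySpace α) :
    dres α (hF.nem (val α W) - β • der α W) = -res α (hF.nem' W) - β • dres α (der α W) := by
  have h2 := dres_val (EnergySpace.mk (α := α) _ _ (hF.hasWeakDeriv_nem W))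
  rw [val_mk, der_mk] at h2
  rw [map_sub, map_smul, h2]

/-- A solution of the evolution equation, together with its first two derivatives in `x`. -/
structure IsFlow (β : ℝ) (W₀ W₁ W₂ : ℝ → EnergySpace α) : Prop where
  hasDerivAt₀ : ∀ t, HasDerivAt W₀ (dres α (hF.nem (val α (W₀ t)) - β • der α (W₀ t))) t
  hasDerivAt₁ : ∀ t, HasDerivAt W₁ (dres α (hF.nem' (W₀ t) - β • der α (W₁ t))) t
  hasDerivAt₂ : ∀ t, HasDerivAt W₂ (dres α (hF.nem'' (W₀ t) (W₁ t) - β • der α (W₂ t))) t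
  der₀ : ∀ t, der α (W₀ t) = val α (W₁ t)
  der₁ : ∀ t, der α (W₁ t) = val α (W₂ t)

theorem exists_isFlow (β : ℝ) {U₀ U₁ U₂ : EnergySpace α} (h₀ : der α U₀ = val α U₁)
    (h₁ : der α U₁ = val α U₂) :
    ∃ W₀ W₁ W₂, hF.IsFlow β W₀ W₁ W₂ ∧ W₀ 0 = U₀ ∧ W₁ 0 = U₁ ∧ W₂ 0 = U₂ := by
  obtain ⟨K, hK⟩ := hF.exists_lipschitzWith_field (α := α) β
  obtain ⟨W₀, hW₀, hd₀⟩ := exists_global_solution hK U₀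
  have hc₀ : Continuous W₀ := continuous_iff_continuousAt.2 fun t => (hd₀ t).continuousAt
  obtain ⟨W₁, hW₁, hder₀, hd₁⟩ := exists_derivative_solution hd₀
    (fun t => hF.hasWeakDeriv_nem (W₀ t)) (hF.continuous_nem'.comp hc₀) (V₀ := U₁)
    (by rw [hW₀, h₀])
  have hc₁ : Continuous W₁ := continuous_iff_continuousAt.2 fun t => (hd₁ t).continuousAt
  obtain ⟨W₂, hW₂, hder₁, hd₂⟩ := exists_derivative_solution hd₁
    (fun t => hF.hasWeakDeriv_nem' (hder₀ t)) (hF.continuous_nem'' hc₀ hc₁)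
    (V₀ := U₂) (by rw [hW₁, h₁])
  exact ⟨W₀, W₁, W₂, ⟨hd₀, hd₁, hd₂, hder₀, hder₁⟩, hW₀, hW₁, hW₂⟩

namespace IsFlow

variable {hF} {W₀ W₁ W₂ : ℝ → EnergySpace α} (S : hF.IsFlow β W₀ W₁ W₂)

include S

theorem continuous₀ : Continuous W₀ :=
  continuous_iff_continuousAt.2 fun t => (S.hasDerivAt₀ t).continuousAt

theorem continuous₁ : Continuous W₁ :=
  continuous_iff_continuousAt.2 fun t => (S.hasDerivAt₁ t).continuousAt

theorem continuous₂ : Continuous W₂ :=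
  continuous_iff_continuousAt.2 fun t => (S.hasDerivAt₂ t).continuousAt

/-- The flux cancels, so there is no forcing and the norm cannot grow. This bound by the initial
norm is what later makes the truncation invisible. -/
theorem energy₀ (hβ : 0 < β) : (∀ t, 0 ≤ t → ‖W₀ t‖ ≤ ‖W₀ 0‖) ∧
    IntegrableOn (fun t => ‖der α (W₀ t)‖ ^ 2) (Ioi 0) := by
  have hc := S.continuous₀
  obtain ⟨h1, h2⟩ := dissipation_estimate (e := fun t => ‖W₀ t‖ ^ 2) (q := fun _ => 0)
    (p := fun t => ‖der α (W₀ t)‖ ^ 2)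
    (mul_pos two_pos hβ) (fun t => hasDerivAt_norm_sq (S.hasDerivAt₀ t)) (fun t => by positivity)
    (by fun_prop) (fun t => by positivity) continuous_const (fun _ => le_rfl)
    integrableOn_zero (fun t _ => by rw [hF.inner_nem_der]; simp)
  refine ⟨fun t ht => ?_, h2⟩
  have := h1 t ht
  simp only [integral_zero, add_zero] at this
  exact abs_le_of_sq_le_sq' this (norm_nonneg _) |>.2

theorem integrableOn_nem' (hβ : 0 < β) :
    IntegrableOn (fun t => ‖hF.nem' (W₀ t)‖ ^ 2) (Ioi 0) := by
  have hc := S.continuous₀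
  have hn := hF.continuous_nem' (α := α)
  refine Integrable.mono' ((S.energy₀ hβ).2.const_mul (hF.lip ^ 2 : ℝ))
    (Continuous.aestronglyMeasurable (by fun_prop)) (.of_forall fun t => ?_)
  rw [Real.norm_of_nonneg (by positivity), ← mul_pow]
  have := hF.norm_nem'_le (W₀ t)
  gcongr

theorem energy₁ (hβ : 0 < β) : (∃ C, ∀ t, 0 ≤ t → ‖W₁ t‖ ≤ C) ∧
    IntegrableOn (fun t => ‖der α (W₁ t)‖ ^ 2) (Ioi 0) := by
  have hc := S.continuous₀
  have hc₁ := S.continuous₁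
  have hn := hF.continuous_nem' (α := α)
  obtain ⟨h1, h2⟩ := dissipation_estimate (e := fun t => ‖W₁ t‖ ^ 2)
    (q := fun t => ‖hF.nem' (W₀ t)‖ ^ 2 / β) (p := fun t => ‖der α (W₁ t)‖ ^ 2)
    hβ (fun t => hasDerivAt_norm_sq (S.hasDerivAt₁ t)) (fun t => by positivity)
    (by fun_prop) (fun t => by positivity) (by fun_prop) (fun _ => by positivity)
    ((S.integrableOn_nem' hβ).div_const _) (fun t _ => two_mul_inner_le hβ _ _)
  exact ⟨⟨_, fun t ht => Real.le_sqrt_of_sq_le (h1 t ht)⟩, h2⟩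

/-- The quadratic term F''(w) w_x² is harmless because `energy₁` bounds w_x uniformly, leaving one
square integrable factor. -/
theorem integrableOn_nem'' (hβ : 0 < β) :
    IntegrableOn (fun t => ‖hF.nem'' (W₀ t) (W₁ t)‖ ^ 2) (Ioi 0) := by
  have hc := S.continuous₀
  have hc₁ := S.continuous₁
  have hn := hF.continuous_nem'' hc hc₁
  obtain ⟨⟨C, hC⟩, h1⟩ := S.energy₁ hβ
  have h0 := (S.energy₀ hβ).2
  refine Integrable.mono' ((h0.const_mul (2 * (hF.lip' * (supConst α * C)) ^ 2 : ℝ)).add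
    (h1.const_mul (2 * hF.lip ^ 2 : ℝ)))
    (Continuous.aestronglyMeasurable (by fun_prop)) ?_
  filter_upwards [ae_restrict_mem measurableSet_Ioi] with t ht
  have ht : 0 ≤ t := le_of_lt ht
  rw [Real.norm_of_nonneg (by positivity)]
  have h2 := hF.norm_nem''_le (W₀ t) (W₁ t)
  rw [← S.der₀ t] at h2
  have h3 : ‖rep α (W₁ t)‖ ≤ supConst α * C :=
    (norm_rep_le _).trans (mul_le_mul_of_nonneg_left (hC t ht) (Real.sqrt_nonneg _))
  have h4 : ‖hF.nem'' (W₀ t) (W₁ t)‖ ≤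
      hF.lip' * (supConst α * C) * ‖der α (W₀ t)‖ + hF.lip * ‖der α (W₁ t)‖ := by
    refine h2.trans ?_
    rw [mul_assoc (hF.lip' : ℝ)]
    gcongr
  calc ‖hF.nem'' (W₀ t) (W₁ t)‖ ^ 2
      ≤ (hF.lip' * (supConst α * C) * ‖der α (W₀ t)‖ + hF.lip * ‖der α (W₁ t)‖) ^ 2 := by gcongr
    _ ≤ 2 * ((hF.lip' * (supConst α * C) * ‖der α (W₀ t)‖) ^ 2 +
          (hF.lip * ‖der α (W₁ t)‖) ^ 2) := add_sq_le
    _ = _ := by simp only [Pi.add_apply]; ring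

theorem energy₂ (hβ : 0 < β) : IntegrableOn (fun t => ‖der α (W₂ t)‖ ^ 2) (Ioi 0) := by
  have hc := S.continuous₀
  have hc₁ := S.continuous₁
  have hc₂ := S.continuous₂
  have hn := hF.continuous_nem'' hc hc₁
  exact (dissipation_estimate (e := fun t => ‖W₂ t‖ ^ 2)
    (q := fun t => ‖hF.nem'' (W₀ t) (W₁ t)‖ ^ 2 / β) (p := fun t => ‖der α (W₂ t)‖ ^ 2)
    hβ (fun t => hasDerivAt_norm_sq (S.hasDerivAt₂ t)) (fun t => by positivity)
    (by fun_prop) (fun t => by positivity) (by fun_prop) (fun _ => by positivity)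
    ((S.integrableOn_nem'' hβ).div_const _) (fun t _ => two_mul_inner_le hβ _ _)).2

/-- The time derivative of the first space derivative is square integrable in time. -/
theorem integrableOn_deriv₁ (hβ : 0 < β) :
    IntegrableOn (fun t => ‖dres α (hF.nem' (W₀ t) - β • der α (W₁ t))‖ ^ 2) (Ioi 0) := by
  have hc := S.continuous₀
  have hc₁ := S.continuous₁
  have hn := hF.continuous_nem' (α := α)
  exact integrableOn_norm_sq_clm _ (by fun_prop) (integrableOn_norm_sq_sub (by fun_prop)
    (by fun_prop) β (S.integrableOn_nem' hβ) (S.energy₁ hβ).2)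

theorem integrableOn_deriv₂ (hβ : 0 < β) :
    IntegrableOn (fun t => ‖dres α (hF.nem'' (W₀ t) (W₁ t) - β • der α (W₂ t))‖ ^ 2) (Ioi 0) := by
  have hc := S.continuous₀
  have hc₁ := S.continuous₁
  have hc₂ := S.continuous₂
  have hn := hF.continuous_nem'' hc hc₁
  exact integrableOn_norm_sq_clm _ (by fun_prop) (integrableOn_norm_sq_sub (by fun_prop)
    (by fun_prop) β (S.integrableOn_nem'' hβ) (S.energy₂ hβ))

theorem integrableOn_deriv₀ (hβ : 0 < β) :
    IntegrableOn (fun t => ‖dres α (hF.nem (val α (W₀ t)) - β • der α (W₀ t))‖ ^ 2) (Ioi 0) := by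
  have hc := S.continuous₀
  have hn := hF.continuous_nem' (α := α)
  simp only [hF.field_eq]
  refine integrableOn_norm_sq_sub (by fun_prop) (by fun_prop) β ?_
    (integrableOn_norm_sq_clm _ (by fun_prop) (S.energy₀ hβ).2)
  simp only [norm_neg]
  exact integrableOn_norm_sq_clm _ (by fun_prop) (S.integrableOn_nem' hβ)

/-- The squared norm is ‖w_x‖² + α‖w_xx‖², and `energy₀` and `energy₁` make both terms integrable in
time. -/
theorem tendsto_norm₁ (hβ : 0 < β) : Tendsto (fun t => ‖W₁ t‖) atTop (𝓝 0) := by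
  have hc := S.continuous₀
  have hc₁ := S.continuous₁
  have hn := hF.continuous_nem' (α := α)
  refine tendsto_norm_zero_of_sq_integrable S.hasDerivAt₁ (by fun_prop) ?_
    (S.integrableOn_deriv₁ hβ)
  simp only [norm_sq, ← S.der₀]
  exact (S.energy₀ hβ).2.add ((S.energy₁ hβ).2.const_mul α)

theorem tendsto_norm₂ (hβ : 0 < β) : Tendsto (fun t => ‖W₂ t‖) atTop (𝓝 0) := by
  have hc := S.continuous₀
  have hc₁ := S.continuous₁
  have hc₂ := S.continuous₂
  have hn := hF.continuous_nem'' hc hc₁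
  refine tendsto_norm_zero_of_sq_integrable S.hasDerivAt₂ (by fun_prop) ?_
    (S.integrableOn_deriv₂ hβ)
  simp only [norm_sq, ← S.der₁]
  exact (S.energy₁ hβ).2.add ((S.energy₂ hβ).const_mul α)

end IsFlow

end CutoffFlux

/-! ### Test functions in space-time -/

/-- The partial derivative in `t`. -/
def dT (p : ℝ × ℝ → ℝ) : ℝ × ℝ → ℝ := fun q => fderiv ℝ p q (1, 0)

/-- The partial derivative in `x`. -/
def dX (p : ℝ × ℝ → ℝ) : ℝ × ℝ → ℝ := fun q => fderiv ℝ p q (0, 1)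

theorem hasDerivAt_dT {p : ℝ × ℝ → ℝ} (hp : ContDiff ℝ ∞ p) (t x : ℝ) :
    HasDerivAt (fun s => p (s, x)) (dT p (t, x)) t := by
  have h1 : HasFDerivAt p (fderiv ℝ p (t, x)) (t, x) :=
    (hp.differentiable (by simp) (t, x)).hasFDerivAt
  exact h1.comp_hasDerivAt t ((hasDerivAt_id t).prodMk (hasDerivAt_const t x))

theorem hasDerivAt_dX {p : ℝ × ℝ → ℝ} (hp : ContDiff ℝ ∞ p) (t x : ℝ) :
    HasDerivAt (fun y => p (t, y)) (dX p (t, x)) x := by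
  have h1 : HasFDerivAt p (fderiv ℝ p (t, x)) (t, x) :=
    (hp.differentiable (by simp) (t, x)).hasFDerivAt
  exact h1.comp_hasDerivAt x ((hasDerivAt_const x t).prodMk (hasDerivAt_id x))

/-- Smooth functions supported in `[δ, R] × [-R, R]`. -/
structure TestFn (δ R : ℝ) (p : ℝ × ℝ → ℝ) : Prop where
  contDiff : ContDiff ℝ ∞ p
  zero_left : ∀ t x, t < δ → p (t, x) = 0
  zero_right : ∀ t x, R < t → p (t, x) = 0
  zero_snd : ∀ t x, R < |x| → p (t, x) = 0

theorem exists_testFn (ψ : 𝓓(halfPlane, ℝ)) : ∃ δ R, 0 < δ ∧ TestFn δ R ψ := by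
  obtain ⟨R, hR⟩ := ψ.hasCompactSupport.isCompact.isBounded.exists_norm_le
  have hz : ∀ q, R < ‖q‖ → ψ q = 0 := fun q hq => by
    by_contra h
    exact absurd (hR q (subset_tsupport _ h)) (not_le.2 hq)
  obtain ⟨δ, hδ, h⟩ : ∃ δ > 0, ∀ q ∈ tsupport ψ, δ ≤ q.1 := by
    rcases (tsupport ψ).eq_empty_or_nonempty with he | hne
    · exact ⟨1, one_pos, by simp [he]⟩
    · obtain ⟨q, hq, hmin⟩ := ψ.hasCompactSupport.isCompact.exists_isMinOn hne
        continuous_fst.continuousOn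
      exact ⟨q.1, ψ.tsupport_subset hq, fun q' hq' => hmin hq'⟩
  refine ⟨δ, R, hδ, ψ.contDiff, fun t x ht => ?_, fun t x ht => hz _ ?_, fun t x hx => hz _ ?_⟩
  · by_contra hne
    exact absurd (h _ (subset_tsupport _ hne)) (not_le.2 ht)
  · exact (ht.trans_le (le_abs_self t)).trans_le (norm_fst_le (t, x))
  · exact hx.trans_le (norm_snd_le (t, x))

/-- The class in `L²` of a time slice. -/
def slice (p : ℝ × ℝ → ℝ) (t : ℝ) : L2 := toL2 fun x => p (t, x)

theorem memLp_of_zero {a : ℝ → ℝ} {R : ℝ} (h : Continuous a) (h0 : ∀ x, R < |x| → a x = 0) :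
    MemLp a 2 volume :=
  h.memLp_of_hasCompactSupport (HasCompactSupport.intro (K := Icc (-R) R) isCompact_Icc
    fun x hx => h0 x (by
      by_contra h'
      exact hx (abs_le.1 (not_lt.1 h'))))

/-- The indicator function of `[-R, R]`. -/
def box (R : ℝ) : L2 :=
  indicatorConstLp 2 (measurableSet_Icc (a := -R) (b := R)) (by simp) (1 : ℝ)

theorem coeFn_box (R : ℝ) : box R =ᵐ[volume] (Icc (-R) R).indicator fun _ => (1 : ℝ) :=
  indicatorConstLp_coeFn

/-- Functions of the form `c + e` with `e ∈ L²`, against functions supported in `[-R, R]`. -/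
theorem integrable_and_integral_mul {v a : ℝ → ℝ} {e : L2} {c R : ℝ}
    (hv : v =ᵐ[volume] fun x => c + e x) (ha : Continuous a) (h0 : ∀ x, R < |x| → a x = 0) :
    Integrable (fun x => v x * a x) ∧
      ∫ x, v x * a x = inner ℝ (e + c • box R) (toL2 a) := by
  have hm := memLp_of_zero ha h0
  -- The constant c is not in L², but a vanishes off [-R, R], so c may be replaced by c times the
  -- indicator of that interval.
  have he : (fun x => (e + c • box R : L2) x * toL2 a x) =ᵐ[volume] fun x => v x * a x := by
    filter_upwards [hv, coeFn_toL2 hm, Lp.coeFn_add e (c • box R), Lp.coeFn_smul c (box R),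
      coeFn_box R] with x h1 h2 h3 h4 h5
    rw [h1, h2, h3, Pi.add_apply, h4, Pi.smul_apply, h5]
    by_cases hx : R < |x|
    · simp [h0 x hx]
    · rw [indicator_of_mem (mem_Icc.2 (abs_le.1 (not_lt.1 hx))), smul_eq_mul]; ring
  refine ⟨(L2.integrable_mul _ _).congr he, ?_⟩
  rw [L2.inner_eq]
  exact (integral_congr_ae he).symm

theorem inner_box {a : ℝ → ℝ} {R : ℝ} (ha : Continuous a) (h0 : ∀ x, R < |x| → a x = 0) :
    inner ℝ (box R) (toL2 a) = ∫ x, a x := by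
  rw [inner_toL2 _ (memLp_of_zero ha h0)]
  refine integral_congr_ae ?_
  filter_upwards [coeFn_box R] with x h5
  rw [h5]
  by_cases hx : R < |x|
  · simp [h0 x hx]
  · rw [indicator_of_mem (mem_Icc.2 (abs_le.1 (not_lt.1 hx))), one_mul]

namespace TestFn

variable {δ R : ℝ} {p q : ℝ × ℝ → ℝ}

theorem dT (h : TestFn δ R p) : TestFn δ R (dT p) := by
  have hz : ∀ t x, (∀ᶠ s in 𝓝 t, p (s, x) = 0) → BBMBurgers.dT p (t, x) = 0 := fun t x he => by
    refine (hasDerivAt_dT h.contDiff t x).unique ?_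
    exact (hasDerivAt_const t (0 : ℝ)).congr_of_eventuallyEq he
  refine ⟨(h.contDiff.fderiv_right (m := ∞) (by simp)).clm_apply contDiff_const,
    fun t x ht => hz t x ?_, fun t x ht => hz t x ?_, fun t x hx => hz t x ?_⟩
  · filter_upwards [gt_mem_nhds ht] with s hs using h.zero_left s x hs
  · filter_upwards [lt_mem_nhds ht] with s hs using h.zero_right s x hs
  · exact .of_forall fun s => h.zero_snd s x hx

theorem dX (h : TestFn δ R p) : TestFn δ R (dX p) := by
  have hz : ∀ t x, (∀ᶠ y in 𝓝 x, p (t, y) = 0) → BBMBurgers.dX p (t, x) = 0 := fun t x he => by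
    refine (hasDerivAt_dX h.contDiff t x).unique ?_
    exact (hasDerivAt_const x (0 : ℝ)).congr_of_eventuallyEq he
  refine ⟨(h.contDiff.fderiv_right (m := ∞) (by simp)).clm_apply contDiff_const,
    fun t x ht => hz t x ?_, fun t x ht => hz t x ?_, fun t x hx => hz t x ?_⟩
  · exact .of_forall fun y => h.zero_left t y ht
  · exact .of_forall fun y => h.zero_right t y ht
  · filter_upwards [continuous_abs.continuousAt.eventually (lt_mem_nhds hx)] with y hy
      using h.zero_snd t y hy

theorem continuous_slice (h : TestFn δ R p) (t : ℝ) : Continuous fun x => p (t, x) :=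
  h.contDiff.continuous.comp (by fun_prop)

theorem memLp_slice (h : TestFn δ R p) (t : ℝ) : MemLp (fun x => p (t, x)) 2 volume :=
  memLp_of_zero (h.continuous_slice t) (h.zero_snd t)

theorem coeFn_slice (h : TestFn δ R p) (t : ℝ) : slice p t =ᵐ[volume] fun x => p (t, x) :=
  coeFn_toL2 (h.memLp_slice t)

theorem slice_eq_zero (h : TestFn δ R p) {t : ℝ} (ht : t < δ ∨ R < t) : slice p t = 0 := by
  refine Lp.ext ?_
  filter_upwards [h.coeFn_slice t, Lp.coeFn_zero ℝ 2 (volume : Measure ℝ)] with x h1 h2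
  rw [h1, h2]
  exact ht.elim (h.zero_left t x) (h.zero_right t x)

theorem bounded (h : TestFn δ R p) : ∃ C, ∀ q, |p q| ≤ C := by
  refine h.contDiff.continuous.bounded_above_of_compact_support
    (HasCompactSupport.intro (K := Icc δ R ×ˢ Icc (-R) R) (isCompact_Icc.prod isCompact_Icc) ?_)
  rintro ⟨t, x⟩ hq
  by_contra hne
  refine hq ⟨⟨?_, ?_⟩, abs_le.1 ?_⟩
  · by_contra h'; exact hne (h.zero_left t x (not_le.1 h'))
  · by_contra h'; exact hne (h.zero_right t x (not_le.1 h'))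
  · by_contra h'; exact hne (h.zero_snd t x (not_le.1 h'))

/-- The time slices form a differentiable curve in `L²`. -/
theorem hasDerivAt_slice (h : TestFn δ R p) (t : ℝ) :
    HasDerivAt (slice p) (slice (BBMBurgers.dT p) t) t := by
  obtain ⟨C, hC⟩ := h.dT.dT.bounded
  have hC0 : 0 ≤ C := (abs_nonneg _).trans (hC 0)
  have h1 : ∀ r x, |BBMBurgers.dT p (r, x) - BBMBurgers.dT p (t, x)| ≤ C * |r - t| := fun r x =>
    convex_univ.norm_image_sub_le_of_norm_hasDerivWithin_le
      (f := fun s => BBMBurgers.dT p (s, x))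
      (fun s _ => (hasDerivAt_dT h.dT.contDiff s x).hasDerivWithinAt)
      (fun s _ => hC _) trivial trivial
  -- A Taylor remainder uniform in x, with C bounding the second time derivative; the support in
  -- [-R, R] then turns it into an L² bound.
  have h2 : ∀ s x, |p (s, x) - p (t, x) - (s - t) * BBMBurgers.dT p (t, x)| ≤
      C * |s - t| ^ 2 := fun s x => by
    have := (convex_uIcc t s).norm_image_sub_le_of_norm_hasDerivWithin_le
      (f := fun r => p (r, x) - r * BBMBurgers.dT p (t, x))
      (f' := fun r => BBMBurgers.dT p (r, x) - BBMBurgers.dT p (t, x)) (C := C * |s - t|)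
      (x := t) (y := s)
      (fun r _ => ((hasDerivAt_dT h.contDiff r x).sub
        ((hasDerivAt_id r).mul_const _ |>.congr_deriv (one_mul _))).hasDerivWithinAt)
      (fun r hr => (h1 r x).trans
        (mul_le_mul_of_nonneg_left (abs_sub_left_of_mem_uIcc hr) hC0))
      left_mem_uIcc right_mem_uIcc
    simp only [Real.norm_eq_abs] at this
    calc _ = |p (s, x) - s * BBMBurgers.dT p (t, x) - (p (t, x) - t * BBMBurgers.dT p (t, x))| := by
          ring_nf
      _ ≤ _ := this
      _ = _ := by ring
  have h3 : ∀ s, ‖slice p s - slice p t - (s - t) • slice (BBMBurgers.dT p) t‖ ≤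
      C * |s - t| ^ 2 * ‖box R‖ := fun s => by
    refine Lp.norm_le_mul_norm_of_ae_le_mul ?_
    filter_upwards [Lp.coeFn_sub (slice p s - slice p t) ((s - t) • slice (BBMBurgers.dT p) t),
      Lp.coeFn_sub (slice p s) (slice p t), Lp.coeFn_smul (s - t) (slice (BBMBurgers.dT p) t),
      h.coeFn_slice s, h.coeFn_slice t, h.dT.coeFn_slice t, coeFn_box R]
      with x e1 e2 e3 e4 e5 e6 e7
    rw [e1, Pi.sub_apply, e2, Pi.sub_apply, e3, Pi.smul_apply, e4, e5, e6, e7]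
    by_cases hx : R < |x|
    · rw [h.zero_snd s x hx, h.zero_snd t x hx, h.dT.zero_snd t x hx]
      simp only [sub_self, smul_zero, norm_zero]
      positivity
    · rw [indicator_of_mem (mem_Icc.2 (abs_le.1 (not_lt.1 hx))), norm_one, mul_one]
      exact h2 s x
  rw [hasDerivAt_iff_isLittleO]
  refine Asymptotics.IsBigO.trans_isLittleO ?_ (Asymptotics.isLittleO_pow_sub_sub t one_lt_two)
  refine Asymptotics.IsBigO.of_bound (C * ‖box R‖) (.of_forall fun s => (h3 s).trans_eq ?_)
  rw [Real.norm_of_nonneg (by positivity), Real.norm_eq_abs]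
  ring

theorem continuous_slices (h : TestFn δ R p) : Continuous (slice p) :=
  continuous_iff_continuousAt.2 fun t => (h.hasDerivAt_slice t).continuousAt

theorem integrable_inner_slice (h : TestFn δ R p) {e : ℝ → L2} (he : Continuous e) :
    Integrable fun t => inner ℝ (e t) (slice p t) := by
  have hc := h.continuous_slices
  refine Continuous.integrable_of_hasCompactSupport (by fun_prop)
    (HasCompactSupport.intro (K := Icc δ R) isCompact_Icc fun t ht => ?_)
  rw [h.slice_eq_zero, inner_zero_right]
  by_contra h'
  rw [not_or, not_lt, not_lt] at h'
  exact ht h'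

/-- Integration by parts in time. -/
theorem integral_inner_slice_dT (h : TestFn δ R p) (hδ : 0 < δ) {e e' : ℝ → L2}
    (he : ∀ t, HasDerivAt e (e' t) t) (hc' : Continuous e') :
    ∫ t in Ioi (0 : ℝ), inner ℝ (e t) (slice (BBMBurgers.dT p) t) =
      -∫ t in Ioi (0 : ℝ), inner ℝ (e' t) (slice p t) := by
  have hc : Continuous e := continuous_iff_continuousAt.2 fun t => (he t).continuousAt
  have i1 := h.integrable_inner_slice hc
  have i2 := h.integrable_inner_slice hc'
  have i3 := h.dT.integrable_inner_slice hc
  have := integral_eq_zero_of_hasDerivAt_of_integrable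
    (fun t => (he t).inner ℝ (h.hasDerivAt_slice t)) (i3.add i2) i1
  rw [integral_add i3 i2] at this
  -- The slices vanish for t < δ with δ > 0, so there is no boundary term at t = 0.
  rw [setIntegral_eq_integral_of_forall_compl_eq_zero,
    setIntegral_eq_integral_of_forall_compl_eq_zero]
  · linarith
  all_goals
    intro t ht
    have ht' : t < δ := (not_lt.1 ht).trans_lt hδ
  · rw [h.slice_eq_zero (Or.inl ht'), inner_zero_right]
  · rw [h.dT.slice_eq_zero (Or.inl ht'), inner_zero_right]

/-- The slice of a test function, as a test function on the line. -/
def lineTest (h : TestFn δ R p) (t : ℝ) : 𝓓((⊤ : Opens ℝ), ℝ) :=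
  ⟨fun x => p (t, x), h.contDiff.comp (by fun_prop),
    HasCompactSupport.intro (K := Icc (-R) R) isCompact_Icc fun x hx => h.zero_snd t x (by
      by_contra h'
      exact hx (abs_le.1 (not_lt.1 h'))), subset_univ _⟩

theorem toL2_lineTest (h : TestFn δ R p) (t : ℝ) : toL2 (h.lineTest t) = slice p t := rfl

theorem toL2_deriv_lineTest (h : TestFn δ R p) (t : ℝ) :
    toL2 (deriv (h.lineTest t)) = slice (BBMBurgers.dX p) t := by
  unfold slice
  congr 1
  funext x
  exact (hasDerivAt_dX h.contDiff t x).deriv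

end TestFn

/-! ### The equation in the sense of distributions -/

open EnergySpace

theorem integral_combination {T : Type*} [MeasurableSpace T] {μ : Measure T}
    {f₁ f₂ f₃ f₄ : T → ℝ} (i₁ : Integrable f₁ μ) (i₂ : Integrable f₂ μ) (i₃ : Integrable f₃ μ)
    (i₄ : Integrable f₄ μ) (a b : ℝ) :
    ∫ x, (f₁ x + f₂ x - a * f₃ x + b * f₄ x) ∂μ =
      (∫ x, f₁ x ∂μ) + (∫ x, f₂ x ∂μ) - a * (∫ x, f₃ x ∂μ) + b * ∫ x, f₄ x ∂μ := by
  have i₁₂ : Integrable (fun x => f₁ x + f₂ x) μ := i₁.add i₂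
  have i₁₂₃ : Integrable (fun x => f₁ x + f₂ x - a * f₃ x) μ := i₁₂.sub (i₃.const_mul a)
  rw [integral_add i₁₂₃ (i₄.const_mul b), integral_sub i₁₂ (i₃.const_mul a), integral_add i₁ i₂,
    integral_const_mul, integral_const_mul]

/-- The inner integral of the weak formulation, in terms of `L²` pairings. -/
theorem integral_weak_integrand {v : ℝ → ℝ} {f : ℝ → ℝ} {e g : L2} {c d R α β : ℝ}
    (hv : v =ᵐ[volume] fun x => c + e x) (hf : (fun x => f (v x)) =ᵐ[volume] fun x => d + g x)
    {a₁ a₂ a₃ a₄ : ℝ → ℝ} (h₁ : Continuous a₁) (h₂ : Continuous a₂) (h₃ : Continuous a₃)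
    (h₄ : Continuous a₄) (z₁ : ∀ x, R < |x| → a₁ x = 0) (z₂ : ∀ x, R < |x| → a₂ x = 0)
    (z₃ : ∀ x, R < |x| → a₃ x = 0) (z₄ : ∀ x, R < |x| → a₄ x = 0) :
    ∫ x, (v x * a₁ x + f (v x) * a₂ x - α * (v x * a₃ x) + β * (v x * a₄ x)) =
      inner ℝ (e + c • box R) (toL2 a₁) + inner ℝ (g + d • box R) (toL2 a₂)
        - α * inner ℝ (e + c • box R) (toL2 a₃) + β * inner ℝ (e + c • box R) (toL2 a₄) := by
  obtain ⟨i₁, e₁⟩ := integrable_and_integral_mul hv h₁ z₁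
  obtain ⟨i₂, e₂⟩ := integrable_and_integral_mul hf h₂ z₂
  obtain ⟨i₃, e₃⟩ := integrable_and_integral_mul hv h₃ z₃
  obtain ⟨i₄, e₄⟩ := integrable_and_integral_mul hv h₄ z₄
  rw [integral_combination i₁ i₂ i₃ i₄, e₁, e₂, e₃, e₄]

/-- The derivative of a compactly supported function has integral zero, so constants drop out of the
flux and viscosity terms. -/
theorem inner_add_box_of_hasDerivAt {e : L2} {c R : ℝ} {a a' : ℝ → ℝ}
    (h : ∀ x, HasDerivAt a (a' x) x) (hc : Continuous a') (z : ∀ x, R < |x| → a x = 0)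
    (z' : ∀ x, R < |x| → a' x = 0) :
    inner ℝ (e + c • box R) (toL2 a') = inner ℝ e (toL2 a') := by
  have hi : ∀ b : ℝ → ℝ, Continuous b → (∀ x, R < |x| → b x = 0) → Integrable b :=
    fun b hb hz => hb.integrable_of_hasCompactSupport
      (HasCompactSupport.intro (K := Icc (-R) R) isCompact_Icc fun x hx => hz x (by
        by_contra h'
        exact hx (abs_le.1 (not_lt.1 h'))))
  have := integral_eq_zero_of_hasDerivAt_of_integrable h (hi a' hc z')
    (hi a (continuous_iff_continuousAt.2 fun x => (h x).continuousAt) z)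
  rw [inner_add_left, real_inner_smul_left, inner_box hc z', this, mul_zero, add_zero]

namespace TestFn

variable {δ R : ℝ} {p : ℝ × ℝ → ℝ}

theorem deriv_fst (h : TestFn δ R p) (t x : ℝ) :
    deriv (fun s => p (s, x)) t = BBMBurgers.dT p (t, x) := (hasDerivAt_dT h.contDiff t x).deriv

theorem deriv_snd (h : TestFn δ R p) (t x : ℝ) :
    deriv (fun y => p (t, y)) x = BBMBurgers.dX p (t, x) := (hasDerivAt_dX h.contDiff t x).deriv

theorem iteratedDeriv_snd (h : TestFn δ R p) (t x : ℝ) :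
    iteratedDeriv 2 (fun y => p (t, y)) x = BBMBurgers.dX (BBMBurgers.dX p) (t, x) := by
  rw [iteratedDeriv_succ, iteratedDeriv_one]
  have : deriv (fun y => p (t, y)) = fun y => BBMBurgers.dX p (t, y) :=
    funext fun y => h.deriv_snd t y
  rw [this, h.dX.deriv_snd]

/-- The inner integral of the weak formulation of the equation. -/
theorem integral_slice (h : TestFn δ R p) {v : ℝ → ℝ} {f : ℝ → ℝ} {e g : L2} {c d α β t : ℝ}
    (hv : v =ᵐ[volume] fun x => c + e x) (hf : (fun x => f (v x)) =ᵐ[volume] fun x => d + g x) :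
    ∫ x, (v x * deriv (fun s => p (s, x)) t + f (v x) * deriv (fun y => p (t, y)) x
        - α * (v x * deriv (fun s => iteratedDeriv 2 (fun y => p (s, y)) x) t)
        + β * (v x * iteratedDeriv 2 (fun y => p (t, y)) x)) =
      inner ℝ (e + c • box R) (slice (BBMBurgers.dT p) t)
        + inner ℝ g (slice (BBMBurgers.dX p) t)
        - α * inner ℝ (e + c • box R) (slice (BBMBurgers.dT (BBMBurgers.dX (BBMBurgers.dX p))) t)
        + β * inner ℝ e (slice (BBMBurgers.dX (BBMBurgers.dX p)) t) := by
  simp only [h.deriv_fst, h.deriv_snd, h.iteratedDeriv_snd, h.dX.dX.deriv_fst]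
  rw [integral_weak_integrand (R := R) hv hf (h.dT.continuous_slice t) (h.dX.continuous_slice t)
    (h.dX.dX.dT.continuous_slice t) (h.dX.dX.continuous_slice t) (h.dT.zero_snd t)
    (h.dX.zero_snd t) (h.dX.dX.dT.zero_snd t) (h.dX.dX.zero_snd t),
    inner_add_box_of_hasDerivAt (hasDerivAt_dX h.contDiff t) (h.dX.continuous_slice t)
      (h.zero_snd t) (h.dX.zero_snd t),
    inner_add_box_of_hasDerivAt (hasDerivAt_dX h.dX.contDiff t) (h.dX.dX.continuous_slice t)
      (h.dX.zero_snd t) (h.dX.dX.zero_snd t)]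
  rfl

end TestFn

/-! ### Properties of the constructed solution -/

/-- The element of `H^k` with prescribed weak derivatives. -/
def sobolevMk {k : ℕ} (w : Fin (k + 1) → L2)
    (h : ∀ j : Fin k, HasWeakDeriv (w j.castSucc) (w j.succ)) :
    SobolevH k := ⟨WithLp.toLp 2 w, h⟩

theorem continuous_sobolevMk {k : ℕ} {T : Type*} [TopologicalSpace T] {w : T → Fin (k + 1) → L2}
    (h : ∀ t, ∀ j : Fin k, HasWeakDeriv (w t j.castSucc) (w t j.succ))
    (hw : ∀ j, Continuous fun t => w t j) : Continuous fun t => sobolevMk (w t) (h t) :=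
  ((PiLp.continuous_toLp 2 _).comp (continuous_pi hw)).subtype_mk _

theorem memLp_sobolevMk {k : ℕ} {w : ℝ → Fin (k + 1) → L2}
    (h : ∀ t, ∀ j : Fin k, HasWeakDeriv (w t j.castSucc) (w t j.succ))
    (hw : ∀ j, Continuous fun t => w t j)
    (hi : ∀ j, IntegrableOn (fun t => ‖w t j‖ ^ 2) (Ioi 0)) :
    MemLp (fun t => sobolevMk (w t) (h t)) 2 (volume.restrict (Ioi 0)) := by
  -- Second countability of the time line suffices for strong measurability of a continuous curve.
  have : SecondCountableTopologyEither ℝ (SobolevH k) := ⟨Or.inl inferInstance⟩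
  rw [memLp_two_iff_integrable_sq_norm (continuous_sobolevMk h hw).aestronglyMeasurable]
  have e : ∀ t, ‖sobolevMk (w t) (h t)‖ ^ 2 = ∑ j, ‖w t j‖ ^ 2 := fun t =>
    PiLp.norm_sq_eq_of_L2 _ _
  simp only [e]
  exact integrable_finsetSum _ fun j _ => hi j

theorem EnergySpace.add_rep_ae_eq {α : ℝ} [Fact (0 < α)] (W : EnergySpace α) (c : ℝ) :
    (fun x => c + rep α W x) =ᵐ[volume] fun x => c + val α W x := by
  filter_upwards [val_ae_rep W] with x hx
  rw [hx]

namespace CutoffFlux.IsFlow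

variable {F : ℝ → ℝ} {hF : CutoffFlux F} {α : ℝ} [hα : Fact (0 < α)] {β : ℝ}
  {W₀ W₁ W₂ : ℝ → EnergySpace α} (S : hF.IsFlow β W₀ W₁ W₂)

include S

theorem continuous_field₀ :
    Continuous fun t => dres α (hF.nem (val α (W₀ t)) - β • der α (W₀ t)) := by
  have hc := S.continuous₀
  have hn := hF.lipschitzWith_nem.continuous
  fun_prop

theorem continuous_field₁ :
    Continuous fun t => dres α (hF.nem' (W₀ t) - β • der α (W₁ t)) := by
  have hc := S.continuous₀
  have hc₁ := S.continuous₁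
  have hn := hF.continuous_nem' (α := α)
  fun_prop

theorem continuous_field₂ :
    Continuous fun t => dres α (hF.nem'' (W₀ t) (W₁ t) - β • der α (W₂ t)) := by
  have hc₂ := S.continuous₂
  have hn := hF.continuous_nem'' S.continuous₀ S.continuous₁
  fun_prop

theorem memCSobolev : MemCSobolev 3 fun t => rep α (W₀ t) := by
  have hc := S.continuous₀
  have hc₁ := S.continuous₁
  have hc₂ := S.continuous₂
  have h : ∀ t, ∀ j : Fin 3,
      HasWeakDeriv ((![val α (W₀ t), val α (W₁ t), val α (W₂ t), der α (W₂ t)] : Fin 4 → L2)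
        j.castSucc)
      ((![val α (W₀ t), val α (W₁ t), val α (W₂ t), der α (W₂ t)] : Fin 4 → L2) j.succ) := by
    intro t j
    have h0 := (W₀ t).hasWeakDeriv
    have h1 := (W₁ t).hasWeakDeriv
    rw [S.der₀] at h0
    rw [S.der₁] at h1
    fin_cases j
    exacts [h0, h1, (W₂ t).hasWeakDeriv]
  refine ⟨fun t => sobolevMk _ (h t), (continuous_sobolevMk h fun j => ?_).continuousOn,
    fun t _ => (val_ae_rep (W₀ t)).symm⟩
  fin_cases j
  · exact (val α).continuous.comp hc
  · exact (val α).continuous.comp hc₁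
  · exact (val α).continuous.comp hc₂
  · exact (der α).continuous.comp hc₂

theorem xDerivMemL2Sobolev (hβ : 0 < β) (c : ℝ) :
    XDerivMemL2Sobolev 2 fun t x => c + rep α (W₀ t) x := by
  have hc₁ := S.continuous₁
  have hc₂ := S.continuous₂
  have h : ∀ t, ∀ j : Fin 2,
      HasWeakDeriv ((![val α (W₁ t), val α (W₂ t), der α (W₂ t)] : Fin 3 → L2) j.castSucc)
      ((![val α (W₁ t), val α (W₂ t), der α (W₂ t)] : Fin 3 → L2) j.succ) := by
    intro t j
    have h1 := (W₁ t).hasWeakDeriv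
    rw [S.der₁] at h1
    fin_cases j
    exacts [h1, (W₂ t).hasWeakDeriv]
  refine ⟨fun t => sobolevMk _ (h t), memLp_sobolevMk h (fun j => ?_) (fun j => ?_),
    .of_forall fun t => ?_⟩
  · fin_cases j
    · exact (val α).continuous.comp hc₁
    · exact (val α).continuous.comp hc₂
    · exact (der α).continuous.comp hc₂
  · fin_cases j
    · change IntegrableOn (fun t => ‖val α (W₁ t)‖ ^ 2) (Ioi 0)
      simp only [← S.der₀]
      exact (S.energy₀ hβ).2
    · change IntegrableOn (fun t => ‖val α (W₂ t)‖ ^ 2) (Ioi 0)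
      simp only [← S.der₁]
      exact (S.energy₁ hβ).2
    · exact S.energy₂ hβ
  · have h1 : HasACDeriv (fun x => c + rep α (W₀ t) x) (val α (W₁ t)) :=
      ⟨fun a b => (contDiff_const.contDiffOn.absolutelyContinuousOnInterval).add
        ((rep_hasACDeriv (W₀ t)).ac a b), by
        filter_upwards [(rep_hasACDeriv (W₀ t)).ae] with x hx
        rw [← S.der₀]
        exact hx.const_add c⟩
    exact h1.hasWeakDeriv

/-- Both sides are the time derivative of the same curve, w_x in L². -/
theorem der_field₀ (t : ℝ) : der α (dres α (hF.nem (val α (W₀ t)) - β • der α (W₀ t))) =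
    val α (dres α (hF.nem' (W₀ t) - β • der α (W₁ t))) := by
  have h1 := (der α).hasFDerivAt.comp_hasDerivAt t (S.hasDerivAt₀ t)
  have h2 := (val α).hasFDerivAt.comp_hasDerivAt t (S.hasDerivAt₁ t)
  have e : der α ∘ W₀ = val α ∘ W₁ := funext S.der₀
  rw [e] at h1
  exact h1.unique h2

theorem der_field₁ (t : ℝ) : der α (dres α (hF.nem' (W₀ t) - β • der α (W₁ t))) =
    val α (dres α (hF.nem'' (W₀ t) (W₁ t) - β • der α (W₂ t))) := by
  have h1 := (der α).hasFDerivAt.comp_hasDerivAt t (S.hasDerivAt₁ t)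
  have h2 := (val α).hasFDerivAt.comp_hasDerivAt t (S.hasDerivAt₂ t)
  have e : der α ∘ W₁ = val α ∘ W₂ := funext S.der₁
  rw [e] at h1
  exact h1.unique h2

theorem tDerivMemL2Sobolev (hβ : 0 < β) (c : ℝ) :
    TDerivMemL2Sobolev 2 fun t x => c + rep α (W₀ t) x := by
  set Z₀ := fun t => dres α (hF.nem (val α (W₀ t)) - β • der α (W₀ t)) with hZ₀
  set Z₁ := fun t => dres α (hF.nem' (W₀ t) - β • der α (W₁ t)) with hZ₁
  set Z₂ := fun t => dres α (hF.nem'' (W₀ t) (W₁ t) - β • der α (W₂ t)) with hZ₂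
  have c₀ : Continuous Z₀ := S.continuous_field₀
  have c₁ : Continuous Z₁ := S.continuous_field₁
  have c₂ : Continuous Z₂ := S.continuous_field₂
  have h : ∀ t, ∀ j : Fin 2,
      HasWeakDeriv ((![val α (Z₀ t), val α (Z₁ t), val α (Z₂ t)] : Fin 3 → L2) j.castSucc)
      ((![val α (Z₀ t), val α (Z₁ t), val α (Z₂ t)] : Fin 3 → L2) j.succ) := by
    intro t j
    have h0 := (Z₀ t).hasWeakDeriv
    have h1 := (Z₁ t).hasWeakDeriv
    rw [S.der_field₀] at h0
    rw [S.der_field₁] at h1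
    fin_cases j
    exacts [h0, h1]
  refine ⟨fun t => sobolevMk _ (h t), memLp_sobolevMk h (fun j => ?_) (fun j => ?_),
    fun ψ => ?_⟩
  · fin_cases j
    · exact (val α).continuous.comp c₀
    · exact (val α).continuous.comp c₁
    · exact (val α).continuous.comp c₂
  · fin_cases j
    · exact integrableOn_norm_sq_clm _ c₀ (S.integrableOn_deriv₀ hβ)
    · exact integrableOn_norm_sq_clm _ c₁ (S.integrableOn_deriv₁ hβ)
    · exact integrableOn_norm_sq_clm _ c₂ (S.integrableOn_deriv₂ hβ)
  · obtain ⟨δ, R, hδ, hψ⟩ := exists_testFn ψ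
    have hd : ∀ t, HasDerivAt (fun t => val α (W₀ t) + c • box R) (val α (Z₀ t)) t := fun t =>
      ((val α).hasFDerivAt.comp_hasDerivAt t (S.hasDerivAt₀ t)).add_const _
    have key := hψ.integral_inner_slice_dT hδ hd ((val α).continuous.comp c₀)
    calc _ = ∫ t in Ioi (0 : ℝ), inner ℝ (val α (W₀ t) + c • box R) (slice (dT ψ) t) := by
          congr 1 with t
          simp only [hψ.deriv_fst]
          exact (integrable_and_integral_mul (add_rep_ae_eq (W₀ t) c) (hψ.dT.continuous_slice t)
            (hψ.dT.zero_snd t)).2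
      _ = _ := key
      _ = _ := by
          congr 2 with t
          exact inner_toL2 _ (hψ.memLp_slice t)

/-- The evolution equation in the energy space implies the equation in the sense of
distributions. -/
theorem solvesEquation {f : ℝ → ℝ} {c : ℝ}
    (hf : ∀ t, 0 ≤ t → ∀ x, F (rep α (W₀ t) x) = f (c + rep α (W₀ t) x) - f c) :
    SolvesEquation α β f fun t x => c + rep α (W₀ t) x := by
  intro ψ
  obtain ⟨δ, R, hδ, hψ⟩ := exists_testFn ψ
  have hd : ∀ t, HasDerivAt (fun t => val α (W₀ t) + c • box R)
      (val α (dres α (hF.nem (val α (W₀ t)) - β • der α (W₀ t)))) t := fun t =>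
    ((val α).hasFDerivAt.comp_hasDerivAt t (S.hasDerivAt₀ t)).add_const _
  have hc := S.continuous₀
  have hn := hF.lipschitzWith_nem.continuous
  have hZ : Continuous fun t => val α (dres α (hF.nem (val α (W₀ t)) - β • der α (W₀ t))) := by
    fun_prop
  have hce : Continuous fun t => val α (W₀ t) + c • box R := by fun_prop
  have k1 := hψ.integral_inner_slice_dT hδ hd hZ
  have k2 := hψ.dX.dX.integral_inner_slice_dT hδ hd hZ
  have i1 := (hψ.dT.integrable_inner_slice hce).integrableOn (s := Ioi 0)
  have i2 := (hψ.dX.dX.dT.integrable_inner_slice hce).integrableOn (s := Ioi 0)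
  have i3 := (hψ.dX.integrable_inner_slice
    (e := fun t => hF.nem (val α (W₀ t))) (by fun_prop)).integrableOn (s := Ioi 0)
  have i4 := (hψ.dX.dX.integrable_inner_slice
    (e := fun t => val α (W₀ t)) (by fun_prop)).integrableOn (s := Ioi 0)
  have i5 := (hψ.integrable_inner_slice hZ).integrableOn (s := Ioi 0)
  have i6 := (hψ.dX.dX.integrable_inner_slice hZ).integrableOn (s := Ioi 0)
  have e1 : ∀ t ∈ Ioi (0 : ℝ), _ = _ := fun t ht =>
    hψ.integral_slice (α := α) (β := β) (f := f) (g := hF.nem (val α (W₀ t))) (d := f c) (t := t)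
      (add_rep_ae_eq (W₀ t) c) (by
        filter_upwards [hF.coeFn_nem (val α (W₀ t)), val_ae_rep (W₀ t)] with x h1 h2
        rw [h1, h2, hf t (le_of_lt ht)]; ring)
  -- The weak identity defining `dres`, tested with the slice of ψ, with the remaining x-derivatives
  -- moved onto ψ.
  have e2 : ∀ t, inner ℝ (val α (dres α (hF.nem (val α (W₀ t)) - β • der α (W₀ t)))) (slice ψ t)
      - α * inner ℝ (val α (dres α (hF.nem (val α (W₀ t)) - β • der α (W₀ t))))
        (slice (dX (dX ψ)) t) =
      inner ℝ (hF.nem (val α (W₀ t))) (slice (dX ψ) t)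
        + β * inner ℝ (val α (W₀ t)) (slice (dX (dX ψ)) t) := fun t => by
    have h1 := inner_dres (α := α) (hF.nem (val α (W₀ t)) - β • der α (W₀ t))
      (test (hψ.lineTest t))
    rw [inner_def, val_test, der_test, hψ.toL2_deriv_lineTest, inner_sub_left,
      real_inner_smul_left, hψ.toL2_lineTest] at h1
    have h2 : ∀ W : EnergySpace α,
        inner ℝ (val α W) (slice (dX (dX ψ)) t) = -inner ℝ (der α W) (slice (dX ψ) t) := by
      intro W
      have := hasWeakDeriv_iff.1 W.hasWeakDeriv (hψ.dX.lineTest t)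
      rwa [hψ.dX.toL2_deriv_lineTest] at this
    rw [h2, h2]
    linarith
  rw [setIntegral_congr_fun measurableSet_Ioi e1]
  have e3 := integral_congr_ae (μ := volume.restrict (Ioi (0 : ℝ))) (.of_forall e2)
  rw [integral_sub i5 (i6.const_mul α), integral_add i3 (i4.const_mul β),
    integral_const_mul, integral_const_mul] at e3
  rw [integral_combination i1 i3 i2 i4, k1, k2]
  linarith

theorem contDiff (c t : ℝ) : ContDiff ℝ 2 (fun x => c + rep α (W₀ t) x) ∧
    deriv (fun x => c + rep α (W₀ t) x) = rep α (W₁ t) ∧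
    iteratedDeriv 2 (fun x => c + rep α (W₀ t) x) = rep α (W₂ t) := by
  have h0 : ∀ x, HasDerivAt (fun x => c + rep α (W₀ t) x) (rep α (W₁ t) x) x := fun x =>
    (hasDerivAt_rep (S.der₀ t) x).const_add c
  have h1 : ∀ x, HasDerivAt (rep α (W₁ t)) (rep α (W₂ t) x) x := hasDerivAt_rep (S.der₁ t)
  have e0 : deriv (fun x => c + rep α (W₀ t) x) = rep α (W₁ t) := funext fun x => (h0 x).deriv
  have e1 : deriv (rep α (W₁ t)) = rep α (W₂ t) := funext fun x => (h1 x).deriv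
  refine ⟨?_, e0, ?_⟩
  · rw [show (2 : WithTop ℕ∞) = 1 + 1 by norm_num, contDiff_succ_iff_deriv]
    refine ⟨fun x => (h0 x).differentiableAt, by simp, ?_⟩
    rw [e0, contDiff_one_iff_deriv, e1]
    exact ⟨fun x => (h1 x).differentiableAt, (rep α (W₂ t)).continuous⟩
  · rw [iteratedDeriv_succ, iteratedDeriv_one, e0, e1]

theorem tendsto_sup (hβ : 0 < β) (c : ℝ) :
    Tendsto (fun t => (⨆ x, ‖(c + rep α (W₀ t) x) - c‖ₑ)
      + (⨆ x, ‖deriv (fun x => c + rep α (W₀ t) x) x‖ₑ)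
      + ⨆ x, ‖iteratedDeriv 2 (fun x => c + rep α (W₀ t) x) x‖ₑ) atTop (𝓝 0) := by
  have hsup : ∀ (g : ℝ → ℝ → ℝ) (M : ℝ → ℝ), (∀ᶠ t in atTop, ∀ x, |g t x| ≤ M t) →
      Tendsto M atTop (𝓝 0) → Tendsto (fun t => ⨆ x, ‖g t x‖ₑ) atTop (𝓝 0) := by
    intro g M hg hM
    have h1 : Tendsto (fun t => ENNReal.ofReal (M t)) atTop (𝓝 0) := by
      simpa using ENNReal.tendsto_ofReal hM
    refine tendsto_of_tendsto_of_tendsto_of_le_of_le' tendsto_const_nhds h1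
      (.of_forall fun _ => bot_le) ?_
    filter_upwards [hg] with t ht
    refine iSup_le fun x => ?_
    rw [← ofReal_norm]
    exact ENNReal.ofReal_le_ofReal (ht x)
  simp only [(S.contDiff c _).2.1, (S.contDiff c _).2.2, add_sub_cancel_left]
  -- `W₀` has only a bounded norm, so decay comes from the product ‖w‖‖w_x‖, whose second factor
  -- tends to zero.
  have t0 := hsup (fun t x => rep α (W₀ t) x) (fun t => √(2 * (‖W₀ 0‖ * ‖W₁ t‖))) (by
      filter_upwards [eventually_ge_atTop 0] with t ht x
      refine Real.abs_le_sqrt ((rep_apply_sq_le (W₀ t) x).trans ?_)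
      rw [S.der₀]
      gcongr
      · exact (norm_val_le _).trans ((S.energy₀ hβ).1 t ht)
      · exact norm_val_le _) (by
      simpa using (((S.tendsto_norm₁ hβ).const_mul ‖W₀ 0‖).const_mul 2).sqrt)
  have t1 := hsup (fun t x => rep α (W₁ t) x) (fun t => supConst α * ‖W₁ t‖)
    (.of_forall fun t x => ((rep α (W₁ t)).norm_coe_le_norm x).trans (norm_rep_le _))
    (by simpa using (S.tendsto_norm₁ hβ).const_mul (supConst α))
  have t2 := hsup (fun t x => rep α (W₂ t) x) (fun t => supConst α * ‖W₂ t‖)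
    (.of_forall fun t x => ((rep α (W₂ t)).norm_coe_le_norm x).trans (norm_rep_le _))
    (by simpa using (S.tendsto_norm₂ hβ).const_mul (supConst α))
  simpa using (t0.add t1).add t2

end CutoffFlux.IsFlow

/-! ### Uniqueness -/

/-! ### Truncation of the flux and product test functions -/

open CutoffFlux

/-- Subtracting f(c) gives F(0) = 0, so that F maps L² to L²; the bump function makes F globally
Lipschitz and leaves it unchanged on the range in use. -/
theorem exists_cutoffFlux {f : ℝ → ℝ} (hf : ContDiff ℝ 2 f) (c M : ℝ) :
    ∃ F, CutoffFlux F ∧ ∀ s, |s| ≤ M → F s = f (c + s) - f c := by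
  let b : ContDiffBump (0 : ℝ) := ⟨|M| + 1, |M| + 2, by positivity, by linarith⟩
  refine ⟨fun s => b s * (f (c + s) - f c), ⟨?_, by simp, b.hasCompactSupport.mul_right⟩,
    fun s hs => ?_⟩
  · exact b.contDiff.mul ((hf.comp (contDiff_const.add contDiff_id)).sub contDiff_const)
  · have : b s = 1 := b.one_of_mem_closedBall (by
      rw [mem_closedBall_zero_iff, Real.norm_eq_abs]
      change |s| ≤ |M| + 1
      linarith [le_abs_self M])
    simp only [this, one_mul]

theorem toL2_const_mul (r : ℝ) {a : ℝ → ℝ} (h : MemLp a 2 volume) :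
    toL2 (fun x => r * a x) = r • toL2 a := by
  refine Lp.ext ?_
  filter_upwards [coeFn_toL2 h, coeFn_toL2 (h.const_mul r), Lp.coeFn_smul r (toL2 a)]
    with x h1 h2 h3
  rw [h2, h3, Pi.smul_apply, h1, smul_eq_mul]

/-- The product of a test function in time and a test function in space. -/
def prodTest (θ : ℝ → ℝ) (h1 : ContDiff ℝ ∞ θ) (h2 : HasCompactSupport θ)
    (h3 : tsupport θ ⊆ Ioi 0) (φ : 𝓓((⊤ : Opens ℝ), ℝ)) : 𝓓(halfPlane, ℝ) :=
  have hs : Function.support (fun q : ℝ × ℝ => θ q.1 * φ q.2) ⊆ tsupport θ ×ˢ tsupport φ :=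
    fun _ hq => ⟨subset_tsupport _ (left_ne_zero_of_mul hq),
      subset_tsupport _ (right_ne_zero_of_mul hq)⟩
  ⟨fun q => θ q.1 * φ q.2, (h1.comp contDiff_fst).mul (φ.contDiff.comp contDiff_snd),
    HasCompactSupport.of_support_subset_isCompact
      (h2.isCompact.prod φ.hasCompactSupport.isCompact) hs,
    (closure_minimal hs ((isClosed_tsupport θ).prod (isClosed_tsupport φ))).trans
      fun _ hq => h3 hq.1⟩

section Slices

variable {θ : ℝ → ℝ} (h1 : ContDiff ℝ ∞ θ) (h2 : HasCompactSupport θ) (h3 : tsupport θ ⊆ Ioi 0)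
  (φ : 𝓓((⊤ : Opens ℝ), ℝ))

/-- The derivative of a test function on the line. -/
def derivTest (φ : 𝓓((⊤ : Opens ℝ), ℝ)) : 𝓓((⊤ : Opens ℝ), ℝ) :=
  ⟨deriv φ, (contDiff_infty_iff_deriv.1 φ.contDiff).2, φ.hasCompactSupport.deriv, subset_univ _⟩

theorem dX_prodTest : dX (prodTest θ h1 h2 h3 φ) = prodTest θ h1 h2 h3 (derivTest φ) := by
  funext ⟨t, x⟩
  have := hasDerivAt_dX (prodTest θ h1 h2 h3 φ).contDiff t x
  exact this.unique (((φ.contDiff.differentiable (by simp) x).hasDerivAt).const_mul (θ t))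

theorem slice_prodTest (t : ℝ) : slice (prodTest θ h1 h2 h3 φ) t = θ t • toL2 φ :=
  toL2_const_mul (θ t) (testFunction_memLp φ)

theorem dT_prodTest_apply (t x : ℝ) : dT (prodTest θ h1 h2 h3 φ) (t, x) = deriv θ t * φ x :=
  (hasDerivAt_dT (prodTest θ h1 h2 h3 φ).contDiff t x).unique
    (((h1.differentiable (by simp) t).hasDerivAt).mul_const (φ x))

theorem slice_dT_prodTest (t : ℝ) :
    slice (dT (prodTest θ h1 h2 h3 φ)) t = deriv θ t • toL2 φ := by
  rw [← toL2_const_mul _ (testFunction_memLp φ)]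
  unfold slice
  simp only [dT_prodTest_apply]

end Slices

theorem inner_der_toL2 {α : ℝ} (W : EnergySpace α) (φ : 𝓓((⊤ : Opens ℝ), ℝ)) :
    inner ℝ (der α W) (toL2 φ) = -inner ℝ (val α W) (toL2 (deriv φ)) := by
  rw [hasWeakDeriv_iff.1 W.hasWeakDeriv, neg_neg]

/-! ### From distributional solutions to the evolution equation -/

variable {α : ℝ} [hα : Fact (0 < α)] {β c : ℝ} {f u₀ : ℝ → ℝ} {v : ℝ → ℝ → ℝ}

/-- Only the H¹ part of the H³ regularity is needed for uniqueness. -/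
theorem IsGlobalSolution.exists_curve (H : IsGlobalSolution α β c f u₀ v) :
    ∃ E : ℝ → EnergySpace α, ContinuousOn E (Ici 0) ∧
      ∀ t ≥ 0, v t =ᵐ[volume] fun x => c + val α (E t) x := by
  obtain ⟨Φ, hΦ, h⟩ := H.regularity
  have hval : ∀ j : Fin 4, Continuous fun w : SobolevH 3 =>
      (w : PiLp 2 fun _ : Fin 4 => L2) j := fun j =>
    (PiLp.continuous_apply 2 _ j).comp continuous_subtype_val
  let I : SobolevH 3 → EnergySpace α := fun w =>
    EnergySpace.mk ((w : PiLp 2 fun _ : Fin 4 => L2) 0) ((w : PiLp 2 fun _ : Fin 4 => L2) 1) (w.2 0)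
  have hI : Continuous I := by
    have h0 := hval 0
    have h1 := hval 1
    exact ((WithLp.prod_continuous_toLp 2 L2 L2).comp
      (h0.prodMk (h1.const_smul (√α)))).subtype_mk _
  refine ⟨fun t => I (Φ t), hI.comp_continuousOn hΦ, fun t ht => ?_⟩
  filter_upwards [h t ht] with x hx
  have e : val α (I (Φ t)) x = sobolevFn (Φ t) x := rfl
  rw [e, ← hx]
  ring

/-- A global solution satisfies the integrated evolution equation in the energy space. -/
theorem IsGlobalSolution.integral_eq (H : IsGlobalSolution α β c f u₀ v) {E : ℝ → EnergySpace α}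
    {T : ℝ} (hT : 0 < T) (hE : Continuous E)
    (hv : ∀ t ∈ Icc 0 T, v t =ᵐ[volume] fun x => c + val α (E t) x)
    {F : ℝ → ℝ} (hF : CutoffFlux F)
    (hFf : ∀ t ∈ Icc 0 T, ∀ x, F (rep α (E t) x) = f (c + rep α (E t) x) - f c) :
    ∀ t ∈ Icc 0 T, E t = E 0 + ∫ s in (0 : ℝ)..t, hF.field β (E s) := by
  obtain ⟨K, hK⟩ := hF.exists_lipschitzWith_field (α := α) β
  have hN : Continuous fun s => hF.field β (E s) := hK.continuous.comp hE
  intro t ht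
  rw [← sub_eq_zero]
  refine eq_zero_of_inner_test_eq_zero fun φ => ?_
  set A : ℝ → ℝ := fun s => inner ℝ (E s) (test φ) with hA
  set b : ℝ → ℝ := fun s => inner ℝ (hF.field β (E s)) (test φ) with hb
  have hAc : Continuous A := by fun_prop
  have hbc : Continuous b := by fun_prop
  set B : ℝ → ℝ := fun s => ∫ r in (0 : ℝ)..s, b r with hB
  have hBd : ∀ s, HasDerivAt B (b s) s := fun s =>
    intervalIntegral.integral_hasDerivAt_right (hbc.intervalIntegrable _ _)
      (hbc.stronglyMeasurableAtFilter _ _) hbc.continuousAt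
  have hBc : Continuous B := continuous_iff_continuousAt.2 fun s => (hBd s).continuousAt
  -- Tested with θ(t)φ(x), the equation says that A - B has zero distributional derivative on (0,
  -- T).
  have hconst : ∃ k, ∀ᵐ s, s ∈ Ioo 0 T → A s - B s = k := by
    refine ae_eq_const_of_integral_mul_deriv_eq_zero isOpen_Ioo ordConnected_Ioo
      (nonempty_Ioo.2 hT) (hAc.sub hBc).locallyIntegrable fun θ h1 h2 h3 => ?_
    have h3' : tsupport θ ⊆ Ioi 0 := h3.trans Ioo_subset_Ioi_self
    have hθ : ∀ s, s ∉ Ioo 0 T → θ s = 0 := fun s hs =>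
      image_eq_zero_of_notMem_tsupport fun h => hs (h3 h)
    have hθ' : ∀ s, s ∉ Ioo 0 T → deriv θ s = 0 := fun s hs =>
      image_eq_zero_of_notMem_tsupport fun h => hs (h3 (tsupport_deriv_subset h))
    have hθd : ∀ s, HasDerivAt θ (deriv θ s) s := fun s =>
      (h1.differentiable (by simp) s).hasDerivAt
    have hθc : Continuous (deriv θ) := h1.continuous_deriv (by simp)
    have hi : ∀ a : ℝ → ℝ, Continuous a → Integrable (fun s => a s * θ s) ∧
        Integrable (fun s => a s * deriv θ s) := fun a ha =>
      ⟨(ha.mul h1.continuous).integrable_of_hasCompactSupport h2.mul_left,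
        (ha.mul hθc).integrable_of_hasCompactSupport h2.deriv.mul_left⟩
    have hparts : ∀ a a' : ℝ → ℝ, (∀ s, HasDerivAt a (a' s) s) → Continuous a' →
        ∫ s, a s * deriv θ s = -∫ s, a' s * θ s := fun a a' ha hca' => by
      have hca : Continuous a := continuous_iff_continuousAt.2 fun s => (ha s).continuousAt
      have := integral_eq_zero_of_hasDerivAt_of_integrable (fun s => (ha s).mul (hθd s))
        ((hi a' hca').1.add (hi a hca).2) (hi a hca).1
      rw [integral_add (hi a' hca').1 (hi a hca).2] at this
      linarith
    set ψ := prodTest θ h1 h2 h3' φ with hψ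
    obtain ⟨δ, R, hδ, hR⟩ := exists_testFn ψ
    -- The constant state contributes `k * deriv θ s`, whose integral vanishes, so k is never
    -- evaluated.
    set k : ℝ := c * inner ℝ (box R) (toL2 φ)
      - α * (c * inner ℝ (box R) (toL2 (derivTest (derivTest φ)))) with hk
    have hinner : ∀ s ∈ Ioi (0 : ℝ), ∫ x, (v s x * deriv (fun r => ψ (r, x)) s
        + f (v s x) * deriv (fun y => ψ (s, y)) x
        - α * (v s x * deriv (fun r => iteratedDeriv 2 (fun y => ψ (r, y)) x) s)
        + β * (v s x * iteratedDeriv 2 (fun y => ψ (s, y)) x)) =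
        A s * deriv θ s + k * deriv θ s + b s * θ s := fun s hs => by
      by_cases hsT : s ∈ Ioo 0 T
      · have hs' := Ioo_subset_Icc_self hsT
        rw [hR.integral_slice (α := α) (β := β) (g := hF.nem (val α (E s))) (d := f c) (hv s hs')
          (by
            filter_upwards [hF.coeFn_nem (val α (E s)), val_ae_rep (E s), hv s hs'] with x e1 e2 e3
            rw [e3, e1, e2, hFf s hs']; ring)]
        simp only [hψ, dX_prodTest, slice_prodTest, slice_dT_prodTest, inner_add_left,
          real_inner_smul_left, real_inner_smul_right]
        have e1 := inner_der_toL2 (E s) φ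
        have e2 := inner_der_toL2 (E s) (derivTest φ)
        have e3 : A s = inner ℝ (val α (E s)) (toL2 φ)
            + α * inner ℝ (der α (E s)) (toL2 (derivTest φ)) := by
          simp only [hA, inner_def, val_test, der_test]; rfl
        have e4 : b s = inner ℝ (hF.nem (val α (E s))) (toL2 (derivTest φ))
            - β * inner ℝ (der α (E s)) (toL2 (derivTest φ)) := by
          simp only [hb, field, inner_dres, der_test, inner_sub_left, real_inner_smul_left]; rfl
        have e5 : deriv (derivTest φ) = derivTest (derivTest φ) := rfl
        rw [e5] at e2
        rw [e3, e4, e2, hk]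
        ring
      -- Outside (0, T) the hypotheses say nothing about v, but θ and its derivative vanish there.
      · simp only [hR.deriv_fst, hR.deriv_snd, hR.iteratedDeriv_snd, hR.dX.dX.deriv_fst]
        simp only [hψ, dX_prodTest, dT_prodTest_apply, hθ' s hsT]
        have e0 : ∀ (χ : 𝓓((⊤ : Opens ℝ), ℝ)) (x : ℝ), prodTest θ h1 h2 h3' χ (s, x) = 0 :=
          fun χ x => by
            change θ s * χ x = 0
            rw [hθ s hsT, zero_mul]
        simp [e0, hθ s hsT]
    have h4 := H.equation ψ
    rw [setIntegral_congr_fun measurableSet_Ioi hinner,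
      setIntegral_eq_integral_of_forall_compl_eq_zero (fun s hs => by
        have : s ∉ Ioo 0 T := fun h => hs h.1
        rw [hθ s this, hθ' s this]; ring)] at h4
    have ik := hi (fun _ => k) continuous_const
    have iAk : Integrable fun s => A s * deriv θ s + k * deriv θ s := (hi A hAc).2.add ik.2
    rw [integral_add iAk (hi b hbc).1, integral_add (hi A hAc).2 ik.2,
      hparts (fun _ => k) (fun _ => 0) (fun s => hasDerivAt_const s k) continuous_const] at h4
    have h5 := hparts B b hBd hbc
    simp only [sub_mul]
    rw [integral_sub (hi A hAc).2 (hi B hBc).2, h5]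
    simp only [zero_mul, integral_zero, neg_zero, add_zero] at h4
    linarith
  obtain ⟨k₂, hk⟩ := hconst
  -- Continuity extends the identity from almost every time in (0, T) to the endpoints, so the
  -- constant is the value at 0.
  have hEq : EqOn (fun s => A s - B s) (fun _ => k₂) (Icc 0 T) := by
    have h1 : EqOn (fun s => A s - B s) (fun _ => k₂) (Ioo 0 T) := by
      refine Measure.eqOn_open_of_ae_eq (μ := volume)
        ((ae_restrict_iff' measurableSet_Ioo).2 hk) isOpen_Ioo (by fun_prop) (by fun_prop)
    refine h1.of_subset_closure (by fun_prop) (by fun_prop) Ioo_subset_Icc_self ?_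
    rw [closure_Ioo hT.ne]
  have h0 := hEq (left_mem_Icc.2 hT.le)
  have h1 := hEq ht
  simp only [hB, intervalIntegral.integral_same] at h0 h1
  have h2 : inner ℝ (∫ s in (0 : ℝ)..t, hF.field β (E s)) (test (α := α) φ) = B t := by
    rw [real_inner_comm]
    have := ((innerSL ℝ (test (α := α) φ)).intervalIntegral_comp_comm
      (hN.intervalIntegrable (μ := volume) 0 t)).symm
    simp only [innerSL_apply_apply] at this
    rw [this]
    simp only [hB, hb, real_inner_comm]
  rw [inner_sub_left, inner_add_left, h2]
  simp only [hB]
  change A t - (A 0 + _) = 0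
  linarith

theorem eq_of_integral_eq {G : Type*} [NormedAddCommGroup G] [NormedSpace ℝ G] [CompleteSpace G]
    {N : G → G} {K : NNReal} (hN : LipschitzWith K N) {x y : ℝ → G} (hx : Continuous x)
    (hy : Continuous y) (h0 : x 0 = y 0) {T : ℝ}
    (ex : ∀ t ∈ Icc 0 T, x t = x 0 + ∫ s in (0 : ℝ)..t, N (x s))
    (ey : ∀ t ∈ Icc 0 T, y t = y 0 + ∫ s in (0 : ℝ)..t, N (y s)) :
    ∀ t ∈ Icc 0 T, x t = y t := by
  have hd : ∀ z : ℝ → G, Continuous z → (∀ t ∈ Icc 0 T, z t = z 0 + ∫ s in (0 : ℝ)..t, N (z s)) →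
      ∀ t ∈ Ico 0 T, HasDerivWithinAt z (N (z t)) (Ici t) t := fun z hz ez t ht => by
    have hc : Continuous fun s => N (z s) := hN.continuous.comp hz
    have h1 : HasDerivAt (fun t => z 0 + ∫ s in (0 : ℝ)..t, N (z s)) (N (z t)) t :=
      (intervalIntegral.integral_hasDerivAt_right (hc.intervalIntegrable _ _)
        (hc.stronglyMeasurableAtFilter _ _) hc.continuousAt).const_add _
    refine h1.hasDerivWithinAt.congr_of_eventuallyEq ?_ (ez t ⟨ht.1, ht.2.le⟩)
    filter_upwards [Icc_mem_nhdsGE ht.2] with s hs using ez s ⟨ht.1.trans hs.1, hs.2⟩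
  exact ODE_solution_unique_of_mem_Icc_right (v := fun _ => N) (s := fun _ => univ)
    (fun _ _ => hN.lipschitzOnWith) hx.continuousOn (hd x hx ex) (fun _ _ => trivial)
    hy.continuousOn (hd y hy ey) (fun _ _ => trivial) h0

/-- Global solutions are unique. -/
theorem IsGlobalSolution.ae_eq (hf : ContDiff ℝ 2 f) (H : IsGlobalSolution α β c f u₀ v)
    {u : ℝ → ℝ → ℝ} (H' : IsGlobalSolution α β c f u₀ u) {t : ℝ} (ht : 0 ≤ t) :
    v t =ᵐ[volume] u t := by
  obtain ⟨E, hE, hv⟩ := H.exists_curve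
  obtain ⟨E', hE', hu⟩ := H'.exists_curve
  -- The added 1 gives an interval of positive length even for t = 0.
  set T := t + 1 with hTdef
  have hT : 0 < T := by positivity
  -- Clamping time to [0, T] extends the curves continuously to all of ℝ.
  let P : ℝ → ℝ := fun s => projIcc 0 T hT.le s
  have hP : Continuous P := continuous_subtype_val.comp continuous_projIcc
  have hPm : ∀ s, P s ∈ Icc 0 T := fun s => (projIcc 0 T hT.le s).2
  have hPe : ∀ s ∈ Icc 0 T, P s = s := fun s hs => by simp only [P, projIcc_of_mem hT.le hs]
  have c1 : Continuous fun s => E (P s) := hE.comp_continuous hP fun s => (hPm s).1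
  have c2 : Continuous fun s => E' (P s) := hE'.comp_continuous hP fun s => (hPm s).1
  obtain ⟨C, hC⟩ := isCompact_Icc.exists_bound_of_continuousOn (c1.continuousOn (s := Icc 0 T))
  obtain ⟨C', hC'⟩ := isCompact_Icc.exists_bound_of_continuousOn (c2.continuousOn (s := Icc 0 T))
  -- The larger of the two bounds is used so that both curves solve the equation with the same
  -- Lipschitz field.
  obtain ⟨F, hF, hFf⟩ := exists_cutoffFlux hf c (supConst α * max C C')
  obtain ⟨K, hK⟩ := hF.exists_lipschitzWith_field (α := α) β
  have hb : ∀ (W : EnergySpace α) x, ‖W‖ ≤ max C C' → |rep α W x| ≤ supConst α * max C C' :=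
    fun W x hW => ((rep α W).norm_coe_le_norm x).trans
      ((norm_rep_le W).trans (mul_le_mul_of_nonneg_left hW (Real.sqrt_nonneg _)))
  have e1 := H.integral_eq hT c1 (fun s hs => by
    rw [hPe s hs]; exact hv s hs.1) hF fun s hs x =>
      hFf _ (hb _ x ((hC s hs).trans (le_max_left _ _)))
  have e2 := H'.integral_eq hT c2 (fun s hs => by
    rw [hPe s hs]; exact hu s hs.1) hF fun s hs x =>
      hFf _ (hb _ x ((hC' s hs).trans (le_max_right _ _)))
  have h0 : E (P 0) = E' (P 0) := by
    rw [hPe 0 ⟨le_rfl, hT.le⟩]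
    refine EnergySpace.ext (Lp.ext ?_)
    filter_upwards [hv 0 le_rfl, hu 0 le_rfl, H.initial, H'.initial] with x a1 a2 a3 a4
    linarith
  have hmem : t ∈ Icc 0 T := ⟨ht, by linarith⟩
  have key := eq_of_integral_eq hK c1 c2 h0 e1 e2 t hmem
  simp only [hPe t hmem] at key
  filter_upwards [hv t ht, hu t ht] with x a1 a2
  rw [a1, a2, key]

theorem HasWeakDeriv.sub_const {v g : ℝ → ℝ} (H : HasWeakDeriv v g) (c : ℝ) :
    HasWeakDeriv (fun x => v x - c) g := by
  have h := (HasACDeriv.of_contDiff (contDiff_const (c := -c))).hasWeakDeriv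
  refine (H.add h).congr (.of_forall fun x => ?_) (.of_forall fun x => ?_)
  · simp [sub_eq_add_neg]
  · simp

end BBMBurgers

end

/-! ### Proof of the main theorem -/

open BBMBurgers BBMBurgers.EnergySpace in
theorem theorem1p5 (α β : ℝ) (hα : 0 < α) (hβ : 0 < β) (c : ℝ)
    (f : ℝ → ℝ) (hf : ContDiff ℝ 2 f) (u₀ : ℝ → ℝ)
    (hu₀ : MemLp (fun x => u₀ x - c) 2 volume)
    (hu₀' : ∃ g : BBMBurgers.SobolevH 2, BBMBurgers.HasWeakDeriv u₀ (BBMBurgers.sobolevFn g)) :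
    ∃ u : ℝ → ℝ → ℝ,
      -- `u` is a global solution with the stated regularity
      BBMBurgers.IsGlobalSolution α β c f u₀ u ∧
      BBMBurgers.XDerivMemL2Sobolev 2 u ∧
      BBMBurgers.TDerivMemL2Sobolev 2 u ∧
      -- it is given by its `C²` representative at every time, and decays uniformly
      (∀ t ≥ 0, ContDiff ℝ 2 (u t)) ∧
      Tendsto (fun t => (⨆ x, ‖u t x - c‖ₑ) + (⨆ x, ‖deriv (u t) x‖ₑ)
        + ⨆ x, ‖iteratedDeriv 2 (u t) x‖ₑ) atTop (𝓝 0) ∧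
      -- uniqueness
      ∀ v : ℝ → ℝ → ℝ, BBMBurgers.IsGlobalSolution α β c f u₀ v →
        ∀ t ≥ 0, v t =ᵐ[volume] u t := by
  have : Fact (0 < α) := ⟨hα⟩
  obtain ⟨g, hg⟩ := hu₀'
  have hw : HasWeakDeriv (toL2 fun x => u₀ x - c) (sobolevFn g) :=
    (hg.sub_const c).congr (coeFn_toL2 hu₀).symm .rfl
  let U₀ : EnergySpace α := EnergySpace.mk _ (g.1 0) hw
  let U₁ : EnergySpace α := EnergySpace.mk (g.1 0) (g.1 1) (g.2 0)
  let U₂ : EnergySpace α := EnergySpace.mk (g.1 1) (g.1 2) (g.2 1)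
  -- The radius is the sup bound belonging to the initial energy. Since the energy does not
  -- increase, the solution stays within it for all t ≥ 0.
  obtain ⟨F, hF, hFf⟩ := exists_cutoffFlux hf c (supConst α * ‖U₀‖)
  obtain ⟨W₀, W₁, W₂, S, h₀, -, -⟩ := hF.exists_isFlow β (U₀ := U₀) (U₁ := U₁) (U₂ := U₂)
    (der_mk _ _ _) (der_mk _ _ _)
  have hsol : IsGlobalSolution α β c f u₀ fun t x => c + rep α (W₀ t) x := by
    refine ⟨?_, ?_, ?_⟩
    · simpa only [add_sub_cancel_left] using S.memCSobolev
    · filter_upwards [val_ae_rep U₀, coeFn_toL2 hu₀] with x h1 h2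
      have e : val α U₀ x = u₀ x - c := h2
      rw [h₀, ← h1, e]
      ring
    · refine S.solvesEquation fun t ht x => hFf _ ?_
      refine ((rep α (W₀ t)).norm_coe_le_norm x).trans ((norm_rep_le _).trans ?_)
      exact mul_le_mul_of_nonneg_left (((S.energy₀ hβ).1 t ht).trans_eq (by rw [h₀]))
        (Real.sqrt_nonneg _)
  exact ⟨_, hsol, S.xDerivMemL2Sobolev hβ c, S.tDerivMemL2Sobolev hβ c,
    fun t _ => (S.contDiff c t).1, S.tendsto_sup hβ c, fun v hv t ht => hv.ae_eq hf hsol ht⟩
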